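/- A set $A\subset\mathbb R^d$ is called uniformly discrete if there is $\delta>0$ with $|r-s|\ge\delta$ for all $r,s\in A$, $r\ne s$. For $\mu\in\mathcal S'(\mathbb R^d)$ the Wigner transform $W(\mu)\in\mathcal S'(\mathbb R^{2d})$ is the extension to tempered distributions of $W(f)(x,\omega)=\int_{\mathbb R^d} f(x+\tfrac t2)\,\overline{f(x-\tfrac t2)}\,e^{-2\pi i\omega\cdot t}\,dt$, defined with respect to the bilinear pairing by $$\langle W(\mu),\Phi\rangle=\langle \mu_u\otimes\overline{\mu}_v,\ (\mathcal F_2\Phi)(\tfrac{u+v}{2},u-v)\rangle,\qquad (\mathcal F_2\Phi)(x,t)=\int_{\mathbb R^d}\Phi(x,\omega)e^{-2\pi i\omega\cdot t}\,d\omega ,\quad \Phi\in\mathcal S(\mathbb R^{2d}),$$ where $\langle\overline\mu,f\rangle=\overline{\langle\mu,\overline f\rangle}$. The Fourier transform is normalized by $\widehat f(\xi)=\int_{\mathbb R^d} f(x)e^{-2\pi i x\cdot\xi}\,dx$. A tempered distribution is called a measure if it acts on compactly supported test functions as integration against a (locally finite) complex Radon measure. Theorem. Let $d\ge 0$, let $A,B\subset\mathbb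 R^d$ be uniformly discrete sets, and let $\mu\in\mathcal S'(\mathbb R^d)$ satisfy $$W(\mu)=\sum_{(r,s)\in A\times B}c_{r,s}\,\delta_{(r,s)}$$ for some complex numbers $c_{r,s}$, the series converging unconditionally in $\mathcal S'(\mathbb R^{2d})$ with respect to pointwise (weak-$*$) convergence. Then $\mu$ is a measure with support contained in $A$, and $\widehat\mu$ is a measure with support contained in $B$. -/

import Mathlib

noncomputable section

namespace SchwartzAux

section Operations

open scoped SchwartzMap FourierTransform LineDeriv ContDiff Topology
open MeasureTheory

set_option maxSynthPendingDepth 3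

variable {E F G H : Type*} [NormedAddCommGroup E] [NormedSpace ℝ E]
  [NormedAddCommGroup F] [NormedSpace ℝ F] [NormedAddCommGroup G] [NormedSpace ℝ G]
  [NormedAddCommGroup H] [NormedSpace ℝ H]

/-- A continuous linear map between Schwartz spaces is bounded with respect to the finite suprema
of the Schwartz seminorms. -/
theorem exists_sup_bound (L : 𝓢(G, ℂ) →L[ℂ] 𝓢(H, ℂ)) (s : Finset (ℕ × ℕ)) :
    ∃ (s' : Finset (ℕ × ℕ)) (C : ℝ), 0 ≤ C ∧ ∀ Φ : 𝓢(G, ℂ),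
      s.sup (schwartzSeminormFamily ℂ H ℂ) (L Φ) ≤ C * s'.sup (schwartzSeminormFamily ℂ G ℂ) Φ := by
  have hb : Seminorm.IsBounded (schwartzSeminormFamily ℂ G ℂ) (schwartzSeminormFamily ℂ H ℂ)
      (L : 𝓢(G, ℂ) →ₗ[ℂ] 𝓢(H, ℂ)) := by
    intro i
    obtain ⟨s, C, -, h⟩ := Seminorm.bound_of_continuous (schwartz_withSeminorms ℂ G ℂ)
      ((schwartzSeminormFamily ℂ H ℂ i).comp (L : 𝓢(G, ℂ) →ₗ[ℂ] 𝓢(H, ℂ)))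
      (((schwartz_withSeminorms ℂ H ℂ).continuous_seminorm i).comp L.continuous)
    exact ⟨s, C, h⟩
  obtain ⟨C, s', h⟩ := Seminorm.isBounded_sup hb s
  exact ⟨s', C, C.2, fun Φ => h Φ⟩

theorem exists_sup_bound_functional (ν : 𝓢'(G, ℂ)) :
    ∃ (s : Finset (ℕ × ℕ)) (C : ℝ), 0 ≤ C ∧ ∀ Φ : 𝓢(G, ℂ),
      ‖ν Φ‖ ≤ C * s.sup (schwartzSeminormFamily ℂ G ℂ) Φ := by
  obtain ⟨s, C, -, h⟩ := Seminorm.bound_of_continuous (schwartz_withSeminorms ℂ G ℂ)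
    ((normSeminorm ℂ ℂ).comp (ν : 𝓢(G, ℂ) →L[ℂ] ℂ).toLinearMap) (continuous_norm.comp ν.continuous)
  exact ⟨s, C, C.2, fun Φ => h Φ⟩

section Family

variable [FiniteDimensional ℝ H] (T : 𝓢(G, ℂ) → H → ℂ) (D : H → 𝓢(G, ℂ) →L[ℂ] 𝓢(G, ℂ))

theorem fderiv_family
    (hder : ∀ Φ u, ∃ L : H →L[ℝ] ℂ, HasFDerivAt (T Φ) L u ∧ ∀ h, L h = T (D h Φ) u)
    (Φ : 𝓢(G, ℂ)) : fderiv ℝ (T Φ) = fun u => ∑ i, ContinuousLinearMap.smulRightL ℝ H ℂ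
      (LinearMap.toContinuousLinearMap ((Module.finBasis ℝ H).coord i))
      (T (D (Module.finBasis ℝ H i) Φ) u) := by
  funext u
  obtain ⟨L, hL, hLT⟩ := hder Φ u
  rw [hL.fderiv]
  ext h
  conv_lhs => rw [← (Module.finBasis ℝ H).sum_repr h, map_sum]
  refine Eq.trans (Finset.sum_congr rfl fun i _ => (L.map_smul _ _).trans
    (congrArg _ (hLT _))) ?_
  simp

theorem contDiff_family
    (hder : ∀ Φ u, ∃ L : H →L[ℝ] ℂ, HasFDerivAt (T Φ) L u ∧ ∀ h, L h = T (D h Φ) u)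
    (n : ℕ) (Φ : 𝓢(G, ℂ)) : ContDiff ℝ n (T Φ) := by
  induction n generalizing Φ with
  | zero =>
    refine contDiff_zero.2 (continuous_iff_continuousAt.2 fun u => ?_)
    obtain ⟨L, hL, -⟩ := hder Φ u
    exact hL.continuousAt
  | succ n ih =>
    rw [show ((n + 1 : ℕ) : WithTop ℕ∞) = (n : WithTop ℕ∞) + 1 by push_cast; rfl,
      contDiff_succ_iff_fderiv]
    refine ⟨fun u => ?_, by simp, ?_⟩
    · obtain ⟨L, hL, -⟩ := hder Φ u
      exact hL.differentiableAt
    · rw [fderiv_family T D hder Φ]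
      exact ContDiff.sum fun i _ => (ContinuousLinearMap.contDiff _).comp (ih _)

theorem bound_family
    (hder : ∀ Φ u, ∃ L : H →L[ℝ] ℂ, HasFDerivAt (T Φ) L u ∧ ∀ h, L h = T (D h Φ) u)
    (k : ℕ) (hbd : ∃ (s : Finset (ℕ × ℕ)) (C : ℝ), 0 ≤ C ∧ ∀ (Φ : 𝓢(G, ℂ)) (u : H),
      ‖u‖ ^ k * ‖T Φ u‖ ≤ C * s.sup (schwartzSeminormFamily ℂ G ℂ) Φ) (n : ℕ) :
    ∃ (s : Finset (ℕ × ℕ)) (C : ℝ), 0 ≤ C ∧ ∀ (Φ : 𝓢(G, ℂ)) (u : H),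
      ‖u‖ ^ k * ‖iteratedFDeriv ℝ n (T Φ) u‖ ≤
        C * s.sup (schwartzSeminormFamily ℂ G ℂ) Φ := by
  induction n with
  | zero => simpa using hbd
  | succ n ih =>
    obtain ⟨s, C, hC, h⟩ := ih
    choose s' C' hC' h' using fun i => exists_sup_bound (D (Module.finBasis ℝ H i)) s
    let c := fun i => ContinuousLinearMap.smulRightL ℝ H ℂ
      (LinearMap.toContinuousLinearMap ((Module.finBasis ℝ H).coord i))
    refine ⟨Finset.univ.biUnion s', ∑ i, ‖c i‖ * (C * C' i),
      Finset.sum_nonneg fun i _ => mul_nonneg (norm_nonneg (c i)) (mul_nonneg hC (hC' i)),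
      fun Φ u => ?_⟩
    rw [← norm_iteratedFDeriv_fderiv, fderiv_family T D hder Φ]
    have hsum : iteratedFDeriv ℝ n (fun u => ∑ i, c i (T (D (Module.finBasis ℝ H i) Φ) u)) u
        = ∑ i, iteratedFDeriv ℝ n (fun u => c i (T (D (Module.finBasis ℝ H i) Φ) u)) u := by
      rw [← iteratedFDeriv_sum_apply (f := fun i u => c i (T (D (Module.finBasis ℝ H i) Φ) u))
        fun i _ => ((c i).contDiff.comp (contDiff_family T D hder n _)).contDiffAt]
      congr 1
      ext u
      simp [Finset.sum_apply]
    change ‖u‖ ^ k * ‖iteratedFDeriv ℝ n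
      (fun u => ∑ i, c i (T (D (Module.finBasis ℝ H i) Φ) u)) u‖ ≤ _
    rw [hsum, Finset.sum_mul]
    refine (mul_le_mul_of_nonneg_left (norm_sum_le _ _) (by positivity)).trans ?_
    rw [Finset.mul_sum]
    refine Finset.sum_le_sum fun i _ => ?_
    have h1 : ‖iteratedFDeriv ℝ n (fun u => c i (T (D (Module.finBasis ℝ H i) Φ) u)) u‖ ≤
        ‖c i‖ * ‖iteratedFDeriv ℝ n (T (D (Module.finBasis ℝ H i) Φ)) u‖ :=
      (c i).norm_iteratedFDeriv_comp_left (contDiff_family T D hder n _).contDiffAt le_rfl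
    calc _ ≤ ‖u‖ ^ k * (‖c i‖ * ‖iteratedFDeriv ℝ n (T (D (Module.finBasis ℝ H i) Φ)) u‖) := by
          gcongr
      _ = ‖c i‖ * (‖u‖ ^ k * ‖iteratedFDeriv ℝ n (T (D (Module.finBasis ℝ H i) Φ)) u‖) := by ring
      _ ≤ ‖c i‖ * (C * (C' i * (s' i).sup (schwartzSeminormFamily ℂ G ℂ) Φ)) := by
          refine mul_le_mul_of_nonneg_left ((h _ u).trans ?_) (norm_nonneg (c i))
          exact mul_le_mul_of_nonneg_left (h' i Φ) hC
      _ ≤ ‖c i‖ * (C * (C' i * (Finset.univ.biUnion s').sup (schwartzSeminormFamily ℂ G ℂ) Φ)) := by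
          have := hC' i
          gcongr
          exact Seminorm.le_def.1 (Finset.sup_mono
            (Finset.subset_biUnion_of_mem s' (Finset.mem_univ i))) Φ
      _ = _ := by ring

/-- A linear family `T Φ` of functions indexed by Schwartz functions whose derivatives are again
members of the family and which decays rapidly, as a continuous linear map of Schwartz spaces. -/
def familyCLM (hadd : ∀ Φ Ψ u, T (Φ + Ψ) u = T Φ u + T Ψ u)
    (hsmul : ∀ (a : ℂ) Φ u, T (a • Φ) u = a • T Φ u)
    (hder : ∀ Φ u, ∃ L : H →L[ℝ] ℂ, HasFDerivAt (T Φ) L u ∧ ∀ h, L h = T (D h Φ) u)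
    (hbd : ∀ k : ℕ, ∃ (s : Finset (ℕ × ℕ)) (C : ℝ), 0 ≤ C ∧ ∀ (Φ : 𝓢(G, ℂ)) (u : H),
      ‖u‖ ^ k * ‖T Φ u‖ ≤ C * s.sup (schwartzSeminormFamily ℂ G ℂ) Φ) :
    𝓢(G, ℂ) →L[ℂ] 𝓢(H, ℂ) :=
  SchwartzMap.mkCLM T hadd hsmul (fun Φ => contDiff_infty.2 fun n => contDiff_family T D hder n Φ)
    fun n => bound_family T D hder n.1 (hbd n.1) n.2

end Family

section Slice

/-- `(slice u Φ) v = Φ (u, v)`. -/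
def slice (u : E) : 𝓢(E × F, ℂ) →L[ℂ] 𝓢(F, ℂ) :=
  SchwartzMap.compCLM ℂ (g := fun v => (u, v))
    (by
      have h : (fun v : F => (u, v)) = fun v => (u, (0 : F)) + ContinuousLinearMap.inr ℝ E F v := by
        ext v <;> simp
      rw [h]
      fun_prop)
    ⟨1, 1, fun v => by
      have := norm_snd_le (u, v)
      simp only [one_mul, pow_one] at *
      linarith⟩

@[simp] theorem slice_apply (u : E) (Φ : 𝓢(E × F, ℂ)) (v : F) : slice u Φ v = Φ (u, v) := rfl

theorem norm_iteratedFDeriv_slice_le (u : E) (Φ : 𝓢(E × F, ℂ)) (n : ℕ) (v : F) :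
    ‖iteratedFDeriv ℝ n (slice u Φ) v‖ ≤ ‖iteratedFDeriv ℝ n Φ (u, v)‖ := by
  have h0 : (slice u Φ : F → ℂ) =
      (fun z => Φ ((u, 0) + z)) ∘ ContinuousLinearMap.inr ℝ E F := by
    ext v; simp
  have hs : ContDiff ℝ n (fun z => Φ ((u, 0) + z)) :=
    (Φ.smooth n).comp (contDiff_const.add contDiff_id)
  rw [h0, ContinuousLinearMap.iteratedFDeriv_comp_right (n := n) _ hs _ le_rfl,
    iteratedFDeriv_comp_add_left]
  refine (ContinuousMultilinearMap.norm_compContinuousLinearMap_le _ _).trans ?_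
  simp only [ContinuousLinearMap.inr_apply, Prod.mk_add_mk, add_zero, zero_add, Finset.prod_const]
  refine mul_le_of_le_one_right (norm_nonneg _) (pow_le_one₀ (norm_nonneg _) ?_)
  exact ContinuousLinearMap.norm_inr_le_one ℝ E F

theorem slice_bound (u : E) (Φ : 𝓢(E × F, ℂ)) (j k n : ℕ) :
    ‖u‖ ^ j * SchwartzMap.seminorm ℂ k n (slice u Φ) ≤ SchwartzMap.seminorm ℂ (j + k) n Φ := by
  rcases (pow_nonneg (norm_nonneg u) j).eq_or_lt with h | h
  · rw [← h, zero_mul]; exact apply_nonneg _ _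
  rw [← le_div_iff₀' h]
  refine SchwartzMap.seminorm_le_bound ℂ k n _ (div_nonneg (apply_nonneg _ _) h.le) fun v => ?_
  rw [le_div_iff₀' h]
  calc _ ≤ ‖(u, v)‖ ^ j * (‖(u, v)‖ ^ k * ‖iteratedFDeriv ℝ n Φ (u, v)‖) := by
        gcongr
        · exact norm_fst_le (u, v)
        · exact norm_snd_le (u, v)
        · exact norm_iteratedFDeriv_slice_le u Φ n v
    _ = ‖(u, v)‖ ^ (j + k) * ‖iteratedFDeriv ℝ n Φ (u, v)‖ := by ring
    _ ≤ _ := SchwartzMap.le_seminorm ℂ _ _ _ _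

theorem slice_sup_bound (j : ℕ) (s : Finset (ℕ × ℕ)) (u : E) (Φ : 𝓢(E × F, ℂ)) :
    ‖u‖ ^ j * s.sup (schwartzSeminormFamily ℂ F ℂ) (slice u Φ) ≤
      (s.image fun p => (j + p.1, p.2)).sup (schwartzSeminormFamily ℂ (E × F) ℂ) Φ := by
  rcases (pow_nonneg (norm_nonneg u) j).eq_or_lt with h | h
  · rw [← h, zero_mul]; exact apply_nonneg _ _
  rw [← le_div_iff₀' h]
  refine Seminorm.finset_sup_apply_le (div_nonneg (apply_nonneg _ _) h.le) fun p hp => ?_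
  rw [le_div_iff₀' h]
  refine (slice_bound u Φ j p.1 p.2).trans ?_
  have hmem : (j + p.1, p.2) ∈ s.image fun p => (j + p.1, p.2) :=
    Finset.mem_image_of_mem (fun p => (j + p.1, p.2)) hp
  have hle : schwartzSeminormFamily ℂ (E × F) ℂ (j + p.1, p.2) ≤
      (s.image fun p => (j + p.1, p.2)).sup (schwartzSeminormFamily ℂ (E × F) ℂ) :=
    Finset.le_sup hmem
  exact hle Φ

end Slice

section Pairing

theorem iteratedFDeriv_fderiv_apply {f : G → ℂ} (hf : ContDiff ℝ ∞ f) (m : G) (n : ℕ) (x : G)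
    (w : Fin n → G) :
    iteratedFDeriv ℝ n (fun y => fderiv ℝ f y m) x w = fderiv ℝ (iteratedFDeriv ℝ n f) x m w := by
  have hd : ∀ n : ℕ, Differentiable ℝ (iteratedFDeriv ℝ n f) := fun n =>
    hf.differentiable_iteratedFDeriv (mod_cast ENat.natCast_lt_top n)
  have hg : ContDiff ℝ ∞ (fun y => fderiv ℝ f y m) :=
    (hf.fderiv_right (m := ∞) (by simp)).clm_apply contDiff_const
  induction n generalizing x with
  | zero =>
    rw [← fderiv_continuousMultilinear_apply_const_apply (hd 0 x)]
    simp
  | succ n ih =>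
    have hI : ContDiff ℝ 2 (fun y => iteratedFDeriv ℝ n f y (Fin.tail w)) :=
      (ContinuousMultilinearMap.apply ℝ (fun _ : Fin n => G) ℂ (Fin.tail w)).contDiff.comp
        (hf.iteratedFDeriv_right (m := 2) (i := n) (WithTop.coe_le_coe.2 (le_top : ((2 + n : ℕ) : ℕ∞) ≤ ⊤)))
    have hI1 : ∀ y, DifferentiableAt ℝ
        (fderiv ℝ (fun y => iteratedFDeriv ℝ n f y (Fin.tail w))) y := fun y =>
      (hI.fderiv_right (m := 1) (by norm_num)).differentiable (by norm_num) y
    rw [iteratedFDeriv_succ_apply_left, ← fderiv_continuousMultilinear_apply_const_apply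
      (hg.differentiable_iteratedFDeriv (mod_cast ENat.natCast_lt_top n) x),
      ← fderiv_continuousMultilinear_apply_const_apply (hd (n + 1) x)]
    have e1 : (fun y => iteratedFDeriv ℝ n (fun y => fderiv ℝ f y m) y (Fin.tail w)) =
        fun y => fderiv ℝ (fun y => iteratedFDeriv ℝ n f y (Fin.tail w)) y m := by
      funext y
      rw [ih, fderiv_continuousMultilinear_apply_const_apply (hd n y)]
    have e2 : (fun y => iteratedFDeriv ℝ (n + 1) f y w) =
        fun y => fderiv ℝ (fun y => iteratedFDeriv ℝ n f y (Fin.tail w)) y (w 0) := by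
      funext y
      rw [iteratedFDeriv_succ_apply_left, fderiv_continuousMultilinear_apply_const_apply (hd n y)]
    rw [e1, e2, fderiv_clm_apply (hI1 x) (differentiableAt_const _),
      fderiv_clm_apply (hI1 x) (differentiableAt_const _)]
    have hsym := (hI.contDiffAt (x := x)).isSymmSndFDerivAt (by simp)
    simpa using hsym.eq (w 0) m

theorem taylor_bound {W W' : Type*} [NormedAddCommGroup W] [NormedSpace ℝ W]
    [NormedAddCommGroup W'] [NormedSpace ℝ W'] {f : G → W} {g : G → W'}
    (I : W' ≃ₗᵢ[ℝ] (G →L[ℝ] W)) (hf : Differentiable ℝ f) (hg : Differentiable ℝ g)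
    (hfg : fderiv ℝ f = I ∘ g) (y s : G) {M : ℝ}
    (hM : ∀ z ∈ segment ℝ y (y + s), ‖fderiv ℝ g z‖ ≤ M) :
    ‖f (y + s) - f y - fderiv ℝ f y s‖ ≤ M * ‖s‖ ^ 2 := by
  have hM0 : 0 ≤ M := (norm_nonneg (fderiv ℝ g y)).trans (hM y (left_mem_segment ℝ _ _))
  have h1 : ∀ z ∈ segment ℝ y (y + s), ‖fderiv ℝ f z - fderiv ℝ f y‖ ≤ M * ‖s‖ := by
    intro z hz
    have h := (convex_segment (𝕜 := ℝ) y (y + s)).norm_image_sub_le_of_norm_fderiv_le (𝕜 := ℝ)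
      (fun z _ => hg z) hM (left_mem_segment ℝ _ _) hz
    rw [hfg, Function.comp_apply, Function.comp_apply, ← map_sub, I.norm_map]
    refine h.trans (mul_le_mul_of_nonneg_left ?_ hM0)
    obtain ⟨t, ht, rfl⟩ := (segment_eq_image' ℝ y (y + s)) ▸ hz
    simp only [add_sub_cancel_left, norm_smul, Real.norm_eq_abs, abs_of_nonneg ht.1]
    exact mul_le_of_le_one_left (norm_nonneg _) ht.2
  have h := (convex_segment (𝕜 := ℝ) y (y + s)).norm_image_sub_le_of_norm_hasFDerivWithin_le'
    (fun z _ => (hf z).hasFDerivAt.hasFDerivWithinAt) h1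
    (left_mem_segment ℝ _ _) (right_mem_segment ℝ _ _)
  simp only [add_sub_cancel_left] at h
  exact h.trans (le_of_eq (by ring))

theorem slice_taylor (Φ : 𝓢(E × F, ℂ)) (u h : E) (k n : ℕ) :
    SchwartzMap.seminorm ℂ k n
      (slice (u + h) Φ - slice u Φ - slice u (∂_{(h, (0 : F))} Φ)) ≤
      SchwartzMap.seminorm ℂ k (n + 2) Φ * ‖h‖ ^ 2 := by
  refine SchwartzMap.seminorm_le_bound ℂ k n _ (by positivity) fun v => ?_
  have e : slice (u + h) Φ - slice u Φ - slice u (∂_{(h, (0 : F))} Φ) =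
      slice u (Φ.compSubConstCLM ℂ (-(h, (0 : F))) - Φ - ∂_{(h, (0 : F))} Φ) := by
    ext v; simp
  rw [e]
  set s : E × F := (h, 0) with hs
  have hsn : ‖s‖ = ‖h‖ := by simp [hs, Prod.norm_def]
  set y : E × F := (u, v) with hy
  set R := Φ.compSubConstCLM ℂ (-s) - Φ - ∂_{s} Φ with hR
  have hd : ∀ n : ℕ, Differentiable ℝ (iteratedFDeriv ℝ n Φ) := fun n =>
    (Φ.smooth ⊤).differentiable_iteratedFDeriv (mod_cast ENat.natCast_lt_top n)
  have hiR : iteratedFDeriv ℝ n R y = iteratedFDeriv ℝ n Φ (y + s) - iteratedFDeriv ℝ n Φ y -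
      fderiv ℝ (iteratedFDeriv ℝ n Φ) y s := by
    have hc : (R : E × F → ℂ) = (fun z => Φ (z + s)) - Φ - ∂_{s} Φ := by
      ext z; simp [hR]
    have c1 : ContDiff ℝ n (fun z => Φ (z + s)) :=
      (Φ.smooth n).comp (contDiff_id.add contDiff_const)
    have c2 : ContDiff ℝ n ((fun z => Φ (z + s)) - (Φ : E × F → ℂ)) := c1.sub (Φ.smooth n)
    rw [hc, iteratedFDeriv_sub_apply c2.contDiffAt
      ((∂_{s} Φ).smooth n).contDiffAt, iteratedFDeriv_sub_apply c1.contDiffAt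
      (Φ.smooth n).contDiffAt, iteratedFDeriv_comp_add_right]
    congr 1
    ext w
    exact iteratedFDeriv_fderiv_apply (Φ.smooth ⊤) s n y w
  refine (mul_le_mul_of_nonneg_left (norm_iteratedFDeriv_slice_le u R n v)
    (by positivity)).trans ?_
  rw [← hy, hiR, ← hsn]
  rcases (pow_nonneg (norm_nonneg v) k).eq_or_lt with h0 | h0
  · rw [← h0, zero_mul]; positivity
  rw [← le_div_iff₀' h0, mul_div_right_comm]
  refine taylor_bound _ (hd n) (hd (n + 1)) (fderiv_iteratedFDeriv) y s fun z hz => ?_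
  rw [le_div_iff₀' h0]
  have hz2 : z.2 = v := by
    obtain ⟨t, -, rfl⟩ := (segment_eq_image' ℝ y (y + s)) ▸ hz
    simp [hy, hs]
  rw [norm_fderiv_iteratedFDeriv]
  refine le_trans ?_ (SchwartzMap.le_seminorm ℂ k (n + 2) Φ z)
  gcongr
  rw [← hz2]
  exact norm_snd_le z

/-- Pairing in the second variable: `(pairSnd ν Φ) u = ν (Φ (u, ·))`. -/
def pairSnd [FiniteDimensional ℝ E] (ν : 𝓢'(F, ℂ)) : 𝓢(E × F, ℂ) →L[ℂ] 𝓢(E, ℂ) :=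
  familyCLM (fun Φ u => ν (slice u Φ)) (fun h => LineDeriv.lineDerivOpCLM ℂ 𝓢(E × F, ℂ) (h, (0 : F)))
    (fun Φ Ψ u => by simp) (fun a Φ u => by simp)
    (fun Φ u => by
      obtain ⟨s, C, hC, hν⟩ := exists_sup_bound_functional ν
      let L : E →ₗ[ℝ] ℂ :=
        { toFun := fun h => ν (slice u (∂_{(h, (0 : F))} Φ))
          map_add' := fun h h' => by
            rw [show ((h + h', (0 : F)) : E × F) = (h, 0) + (h', 0) by simp,
              LineDeriv.lineDerivOp_left_add, map_add, map_add]
          map_smul' := fun c h => by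
            rw [show ((c • h, (0 : F)) : E × F) = c • (h, 0) by simp,
              LineDeriv.lineDerivOp_left_smul]
            have : slice u (c • ∂_{(h, (0 : F))} Φ) = (c : ℂ) • slice u (∂_{(h, (0 : F))} Φ) := by
              ext v; simp
            rw [this, map_smul]
            simp }
      refine ⟨LinearMap.toContinuousLinearMap L, ?_, fun h => rfl⟩
      let M := s.sup (fun p => (SchwartzMap.seminorm ℂ p.1 (p.2 + 2) : Seminorm ℂ 𝓢(E × F, ℂ))) Φ
      rw [hasFDerivAt_iff_isLittleO_nhds_zero]
      refine Asymptotics.IsBigO.trans_isLittleO (g := fun h : E => ‖h‖ ^ 2) ?_ ?_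
      · refine Asymptotics.IsBigO.of_bound (C * M) (Filter.Eventually.of_forall fun h => ?_)
        change ‖ν (slice (u + h) Φ) - ν (slice u Φ) - ν (slice u (∂_{(h, (0 : F))} Φ))‖ ≤ _
        rw [← map_sub, ← map_sub]
        refine (hν _).trans ?_
        rw [mul_assoc]
        refine mul_le_mul_of_nonneg_left ?_ hC
        have hM : 0 ≤ M := apply_nonneg _ _
        refine Seminorm.finset_sup_apply_le (by positivity) fun p hp => ?_
        refine (slice_taylor Φ u h p.1 p.2).trans ?_
        simp only [norm_pow, norm_norm]
        refine mul_le_mul_of_nonneg_right ?_ (by positivity)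
        exact (Finset.le_sup (f := fun p : ℕ × ℕ =>
          (SchwartzMap.seminorm ℂ p.1 (p.2 + 2) : Seminorm ℂ 𝓢(E × F, ℂ))) hp) Φ
      · have h2 : (fun h : E => ‖h‖ ^ 2) =o[𝓝 0] fun h : E => ‖h‖ ^ 1 :=
          Asymptotics.isLittleO_norm_pow_norm_pow (by norm_num)
        refine h2.trans_isBigO ?_
        simpa using (Asymptotics.isBigO_refl (fun h : E => h) (𝓝 0)).norm_left)
    (fun k => by
      obtain ⟨s, C, hC, hν⟩ := exists_sup_bound_functional ν
      refine ⟨s.image fun p => (k + p.1, p.2), C, hC, fun Φ u => ?_⟩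
      calc _ ≤ ‖u‖ ^ k * (C * s.sup (schwartzSeminormFamily ℂ F ℂ) (slice u Φ)) := by
            gcongr; exact hν _
        _ = C * (‖u‖ ^ k * s.sup (schwartzSeminormFamily ℂ F ℂ) (slice u Φ)) := by ring
        _ ≤ _ := mul_le_mul_of_nonneg_left (slice_sup_bound k s u Φ) hC)

@[simp] theorem pairSnd_apply [FiniteDimensional ℝ E] (ν : 𝓢'(F, ℂ)) (Φ : 𝓢(E × F, ℂ))
    (u : E) : pairSnd ν Φ u = ν (slice u Φ) := rfl

end Pairing

section PartialFourier

variable {V : Type*} [NormedAddCommGroup V] [InnerProductSpace ℝ V]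

/-- The exponent `(x, t) ↦ -2πi ⟨w, t⟩` of the partial Fourier kernel. -/
def phase (E : Type*) [NormedAddCommGroup E] [NormedSpace ℝ E] (w : V) : E × V →L[ℝ] ℂ :=
  (Complex.I * (-2 * Real.pi)) • (Complex.ofRealCLM ∘L innerSL ℝ w ∘L ContinuousLinearMap.snd ℝ E V)

theorem phase_apply (w : V) (p : E × V) :
    phase E w p = Complex.I * (-2 * Real.pi) * (inner ℝ w p.2 : ℝ) := by
  simp [phase]

theorem norm_phase_le (w : V) : ‖phase E w‖ ≤ 2 * Real.pi * ‖w‖ := by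
  refine ContinuousLinearMap.opNorm_le_bound _ (by positivity) fun p => ?_
  rw [phase_apply]
  have h1 : ‖(inner ℝ w p.2 : ℝ)‖ ≤ ‖w‖ * ‖p‖ :=
    (norm_inner_le_norm _ _).trans (mul_le_mul_of_nonneg_left (norm_snd_le p) (norm_nonneg _))
  have h2 : ‖Complex.I * (-2 * Real.pi) * ((inner ℝ w p.2 : ℝ) : ℂ)‖ =
      2 * Real.pi * ‖(inner ℝ w p.2 : ℝ)‖ := by
    simp [abs_of_pos Real.pi_pos]
  rw [h2, mul_assoc (2 * Real.pi)]
  gcongr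

theorem continuous_phase : Continuous (phase E : V → E × V →L[ℝ] ℂ) := by
  unfold phase
  fun_prop

theorem norm_exp_phase (w : V) (p : E × V) : ‖Complex.exp (phase E w p)‖ = 1 := by
  rw [phase_apply, Complex.norm_exp]
  simp

/-- The derivative of the partial Fourier integrand. -/
def kernelDeriv (Φ : 𝓢(E × V, ℂ)) (p : E × V) (w : V) : E × V →L[ℝ] ℂ :=
  Complex.exp (phase E w p) • (fderiv ℝ Φ (p.1, w) ∘L
      (ContinuousLinearMap.inl ℝ E V ∘L ContinuousLinearMap.fst ℝ E V)) +
    Φ (p.1, w) • (Complex.exp (phase E w p) • phase E w)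

theorem hasFDerivAt_kernel (Φ : 𝓢(E × V, ℂ)) (p : E × V) (w : V) :
    HasFDerivAt (fun p : E × V => Complex.exp (phase E w p) * Φ (p.1, w)) (kernelDeriv Φ p w) p := by
  have h1 : HasFDerivAt (fun p : E × V => Complex.exp (phase E w p))
      (Complex.exp (phase E w p) • phase E w) p := (phase E w).hasFDerivAt.cexp
  have h2 : HasFDerivAt (fun p : E × V => ((p.1, w) : E × V))
      (ContinuousLinearMap.inl ℝ E V ∘L ContinuousLinearMap.fst ℝ E V) p := by
    have := (hasFDerivAt_fst (𝕜 := ℝ) (p := p)).prodMk (hasFDerivAt_const w p)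
    rwa [show ContinuousLinearMap.inl ℝ E V ∘L ContinuousLinearMap.fst ℝ E V =
      (ContinuousLinearMap.fst ℝ E V).prod 0 by ext <;> simp]
  exact h1.mul ((Φ.hasFDerivAt (p.1, w)).comp p h2)

theorem continuous_kernelDeriv (Φ : 𝓢(E × V, ℂ)) (p : E × V) :
    Continuous (kernelDeriv Φ p) := by
  have h1 : Continuous (fderiv ℝ Φ) := (Φ.smooth 1).continuous_fderiv (by norm_num)
  have h2 : Continuous fun w : V => Complex.exp (phase E w p) :=
    Complex.continuous_exp.comp (continuous_phase.clm_apply continuous_const)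
  have h3 : Continuous fun w : V => ((p.1, w) : E × V) := by fun_prop
  exact (h2.smul ((h1.comp h3).clm_comp continuous_const)).add
    ((Φ.continuous.comp h3).smul (h2.smul continuous_phase))

theorem phase_temperate (h : E × V) :
    Function.HasTemperateGrowth (fun p : E × V => phase E p.2 h) := by
  have : (fun p : E × V => phase E p.2 h) = ((Complex.I * (-2 * Real.pi)) •
      (Complex.ofRealCLM ∘L innerSL ℝ h.2 ∘L ContinuousLinearMap.snd ℝ E V) :
        E × V →L[ℝ] ℂ) := by
    funext p
    simp [phase_apply, real_inner_comm]
  rw [this]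
  exact ContinuousLinearMap.hasTemperateGrowth _

/-- The derivative of the partial Fourier transform is the partial Fourier transform of this. -/
def fourierSndDeriv (h : E × V) : 𝓢(E × V, ℂ) →L[ℂ] 𝓢(E × V, ℂ) :=
  LineDeriv.lineDerivOpCLM ℂ 𝓢(E × V, ℂ) (h.1, (0 : V)) +
    SchwartzMap.smulLeftCLM ℂ (fun p : E × V => phase E p.2 h)

variable [FiniteDimensional ℝ V] [MeasurableSpace V] [BorelSpace V]

theorem fourier_slice_eq (Φ : 𝓢(E × V, ℂ)) (p : E × V) :
    𝓕 (slice p.1 Φ) p.2 = ∫ w, Complex.exp (phase E w p) * Φ (p.1, w) := by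
  rw [SchwartzMap.fourier_coe, Real.fourier_eq']
  congr 1
  ext w
  simp only [slice_apply, smul_eq_mul, phase_apply]
  congr 2
  push_cast
  ring

theorem exists_kernel_bound (Φ : 𝓢(E × V, ℂ)) : ∃ b : V → ℝ, Integrable b ∧
    ∀ (p : E × V) (w : V), ‖kernelDeriv Φ p w‖ ≤ b w := by
  set N : ℕ := Module.finrank ℝ V + 1 with hN
  set C : ℝ := 2 ^ (N + 1) * (Finset.Iic (N + 1, 1)).sup
    (fun m => SchwartzMap.seminorm ℂ m.1 m.2) Φ with hC
  refine ⟨fun w => (C + 2 * Real.pi * C) * (1 + ‖w‖) ^ (-(N : ℝ)),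
    (integrable_one_add_norm (by rw [hN]; push_cast; linarith)).const_mul _, fun p w => ?_⟩
  have hw : ‖w‖ ≤ ‖((p.1, w) : E × V)‖ := norm_snd_le (p.1, w)
  have hpos : 0 < (1 + ‖w‖) ^ N := by positivity
  have b1 : (1 + ‖w‖) ^ N * ‖fderiv ℝ Φ (p.1, w)‖ ≤ C := by
    rw [← norm_iteratedFDeriv_one]
    refine le_trans ?_ (SchwartzMap.one_add_le_sup_seminorm_apply (𝕜 := ℂ) (m := (N + 1, 1))
      (k := N) (n := 1) (by simp) le_rfl Φ (p.1, w))
    gcongr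
  have b2 : (1 + ‖w‖) ^ N * (‖w‖ * ‖Φ (p.1, w)‖) ≤ C := by
    rw [← norm_iteratedFDeriv_zero (𝕜 := ℝ) (f := Φ)]
    refine le_trans ?_ (SchwartzMap.one_add_le_sup_seminorm_apply (𝕜 := ℂ) (m := (N + 1, 1))
      (k := N + 1) (n := 0) (by simp) (by simp) Φ (p.1, w))
    rw [← mul_assoc]
    refine mul_le_mul_of_nonneg_right ?_ (norm_nonneg _)
    rw [pow_succ (1 + ‖((p.1, w) : E × V)‖) N]
    have h1 : 1 + ‖w‖ ≤ 1 + ‖((p.1, w) : E × V)‖ := by linarith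
    have h2 : ‖w‖ ≤ 1 + ‖((p.1, w) : E × V)‖ := by linarith
    gcongr
  have b3 : ‖kernelDeriv Φ p w‖ ≤ ‖fderiv ℝ Φ (p.1, w)‖ + 2 * Real.pi * (‖w‖ * ‖Φ (p.1, w)‖) := by
    rw [kernelDeriv]
    refine (norm_add_le _ _).trans (add_le_add ?_ ?_)
    · rw [norm_smul, norm_exp_phase, one_mul]
      refine ContinuousLinearMap.opNorm_le_bound _ (norm_nonneg _) fun q => ?_
      refine (ContinuousLinearMap.le_opNorm (fderiv ℝ Φ (p.1, w)) (q.1, 0)).trans ?_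
      gcongr
      simp [Prod.norm_def]
    · rw [norm_smul, norm_smul, norm_exp_phase, one_mul]
      calc _ ≤ ‖Φ (p.1, w)‖ * (2 * Real.pi * ‖w‖) := by
            gcongr; exact norm_phase_le w
        _ = _ := by ring
  change _ ≤ (C + 2 * Real.pi * C) * (1 + ‖w‖) ^ (-(N : ℝ))
  rw [Real.rpow_neg (by positivity), Real.rpow_natCast, ← div_eq_mul_inv, le_div_iff₀' hpos]
  calc _ ≤ (1 + ‖w‖) ^ N * (‖fderiv ℝ Φ (p.1, w)‖ +
          2 * Real.pi * (‖w‖ * ‖Φ (p.1, w)‖)) := by gcongr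
    _ = (1 + ‖w‖) ^ N * ‖fderiv ℝ Φ (p.1, w)‖ +
          2 * Real.pi * ((1 + ‖w‖) ^ N * (‖w‖ * ‖Φ (p.1, w)‖)) := by ring
    _ ≤ _ := by gcongr

theorem hasFDerivAt_fourier_slice (Φ : 𝓢(E × V, ℂ)) (p : E × V) :
    ∃ L : E × V →L[ℝ] ℂ, HasFDerivAt (fun p : E × V => 𝓕 (slice p.1 Φ) p.2) L p ∧
      ∀ h, L h = 𝓕 (slice p.1 (fourierSndDeriv h Φ)) p.2 := by
  obtain ⟨b, hb, hbound⟩ := exists_kernel_bound Φ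
  have hcont : ∀ p : E × V, Continuous fun w => Complex.exp (phase E w p) * Φ (p.1, w) := fun p =>
    (Complex.continuous_exp.comp (continuous_phase.clm_apply continuous_const)).mul
      (Φ.continuous.comp (by fun_prop))
  have hint : Integrable (kernelDeriv Φ p) :=
    hb.mono' (continuous_kernelDeriv Φ p).aestronglyMeasurable
      (Filter.Eventually.of_forall (hbound p))
  refine ⟨∫ w, kernelDeriv Φ p w, ?_, fun h => ?_⟩
  · simp_rw [fourier_slice_eq]
    refine hasFDerivAt_integral_of_dominated_of_fderiv_le (s := Set.univ) (bound := b)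
      Filter.univ_mem (Filter.Eventually.of_forall fun p => (hcont p).aestronglyMeasurable) ?_
      (continuous_kernelDeriv Φ p).aestronglyMeasurable
      (Filter.Eventually.of_forall fun w p _ => hbound p w) hb
      (Filter.Eventually.of_forall fun w p _ => hasFDerivAt_kernel Φ p w)
    refine ((slice p.1 Φ).integrable (μ := volume)).mono (hcont p).aestronglyMeasurable
      (Filter.Eventually.of_forall fun w => ?_)
    rw [norm_mul, norm_exp_phase, one_mul, slice_apply]
  · rw [ContinuousLinearMap.integral_apply hint, fourier_slice_eq]
    congr 1
    ext w
    simp only [kernelDeriv, fourierSndDeriv, add_apply,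
      smul_apply, ContinuousLinearMap.comp_apply,
      LineDeriv.lineDerivOpCLM_apply, SchwartzMap.lineDerivOp_apply_eq_fderiv,
      SchwartzMap.smulLeftCLM_apply_apply (phase_temperate h), smul_eq_mul,
      ContinuousLinearMap.coe_fst', ContinuousLinearMap.inl_apply]
    ring

variable [FiniteDimensional ℝ E]

/-- The partial Fourier transform in the second variable,
`(fourierSnd Φ) (x, t) = ∫ w, e^{-2πi ⟨w, t⟩} Φ (x, w)`. -/
def fourierSnd : 𝓢(E × V, ℂ) →L[ℂ] 𝓢(E × V, ℂ) :=
  familyCLM (fun Φ p => 𝓕 (slice p.1 Φ) p.2) fourierSndDeriv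
    (fun Φ Ψ p => by simp [FourierTransform.fourier_add])
    (fun a Φ p => by simp [FourierTransform.fourier_smul])
    hasFDerivAt_fourier_slice
    (fun k => by
      obtain ⟨s, C, hC, hF⟩ := exists_sup_bound (SchwartzMap.fourierTransformCLM ℂ (V := V) (E := ℂ))
        {(k, 0), (0, 0)}
      have hsem : ∀ (j : ℕ) (f : 𝓢(V, ℂ)) (t : V), j = k ∨ j = 0 →
          ‖t‖ ^ j * ‖𝓕 f t‖ ≤ C * s.sup (schwartzSeminormFamily ℂ V ℂ) f := fun j f t hj => by
        refine (SchwartzMap.norm_pow_mul_le_seminorm ℂ (𝓕 f) j t).trans (le_trans ?_ (hF f))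
        have hle : schwartzSeminormFamily ℂ V ℂ (j, 0) ≤
            ({(k, 0), (0, 0)} : Finset (ℕ × ℕ)).sup (schwartzSeminormFamily ℂ V ℂ) :=
          Finset.le_sup (by rcases hj with rfl | rfl <;> simp)
        exact hle (𝓕 f)
      refine ⟨(s.image fun p => (k + p.1, p.2)) ∪ s.image fun p => (0 + p.1, p.2), C + C,
        by positivity, fun Φ p => ?_⟩
      have hk : ‖p‖ ^ k ≤ ‖p.1‖ ^ k + ‖p.2‖ ^ k := by
        rcases max_choice ‖p.1‖ ‖p.2‖ with h | h
        · rw [Prod.norm_def, h]; exact le_add_of_nonneg_right (by positivity)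
        · rw [Prod.norm_def, h]; exact le_add_of_nonneg_left (by positivity)
      have h1 := hsem 0 (slice p.1 Φ) p.2 (Or.inr rfl)
      have h2 := hsem k (slice p.1 Φ) p.2 (Or.inl rfl)
      have h3 := slice_sup_bound k s p.1 Φ
      have h4 := slice_sup_bound 0 s p.1 Φ
      rw [pow_zero, one_mul] at h1 h4
      have m1 : (s.image fun p => (k + p.1, p.2)).sup (schwartzSeminormFamily ℂ (E × V) ℂ) Φ ≤ _ :=
        Seminorm.le_def.1 (Finset.sup_mono (Finset.subset_union_left
          (s₂ := s.image fun p => (0 + p.1, p.2)))) Φ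
      have m2 : (s.image fun p => (0 + p.1, p.2)).sup (schwartzSeminormFamily ℂ (E × V) ℂ) Φ ≤ _ :=
        Seminorm.le_def.1 (Finset.sup_mono (Finset.subset_union_right
          (s₁ := s.image fun p => (k + p.1, p.2)))) Φ
      calc _ ≤ (‖p.1‖ ^ k + ‖p.2‖ ^ k) * ‖𝓕 (slice p.1 Φ) p.2‖ := by gcongr
        _ = ‖p.1‖ ^ k * ‖𝓕 (slice p.1 Φ) p.2‖ + ‖p.2‖ ^ k * ‖𝓕 (slice p.1 Φ) p.2‖ := by ring
        _ ≤ ‖p.1‖ ^ k * (C * s.sup (schwartzSeminormFamily ℂ V ℂ) (slice p.1 Φ)) +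
            C * s.sup (schwartzSeminormFamily ℂ V ℂ) (slice p.1 Φ) := by gcongr
        _ = C * (‖p.1‖ ^ k * s.sup (schwartzSeminormFamily ℂ V ℂ) (slice p.1 Φ)) +
            C * s.sup (schwartzSeminormFamily ℂ V ℂ) (slice p.1 Φ) := by ring
        _ ≤ C * _ + C * _ := add_le_add (mul_le_mul_of_nonneg_left (h3.trans m1) hC)
            (mul_le_mul_of_nonneg_left (h4.trans m2) hC)
        _ = _ := by ring)

theorem fourierSnd_apply (Φ : 𝓢(E × V, ℂ)) (x : E) (t : V) :
    fourierSnd Φ (x, t) = ∫ w, Complex.exp (-2 * Real.pi * Complex.I * (inner ℝ w t : ℝ)) *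
      Φ (x, w) := by
  refine (fourier_slice_eq Φ (x, t)).trans ?_
  congr 1
  ext w
  rw [phase_apply]
  congr 2
  ring

end PartialFourier

section Conj

/-- Pointwise complex conjugation of Schwartz functions. -/
def conjSchwartz : 𝓢(E, ℂ) →SL[starRingEnd ℂ] 𝓢(E, ℂ) :=
  SchwartzMap.mkCLM (fun f x => starRingEnd ℂ (f x)) (fun f g x => by simp) (fun a f x => by simp)
    (fun f => (Complex.conjCLE : ℂ →L[ℝ] ℂ).contDiff.comp (f.smooth ⊤))
    (fun n => ⟨{n}, 1, zero_le_one, fun f x => by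
      have h : ‖iteratedFDeriv ℝ n.2 (fun x => starRingEnd ℂ (f x)) x‖ =
          ‖iteratedFDeriv ℝ n.2 f x‖ :=
        Complex.conjLIE.norm_iteratedFDeriv_comp_left f x n.2
      rw [h, one_mul, Finset.sup_singleton]
      exact SchwartzMap.le_seminorm ℂ n.1 n.2 f x⟩)

@[simp] theorem conjSchwartz_apply (f : 𝓢(E, ℂ)) (x : E) :
    conjSchwartz f x = starRingEnd ℂ (f x) := rfl

end Conj

section Symmetric

/-- The linear change of variables `(u, v) ↦ ((u + v) / 2, u - v)`, whose inverse is
`(x, t) ↦ (x + t / 2, x - t / 2)`. -/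
def symmEquiv (E : Type*) [NormedAddCommGroup E] [NormedSpace ℝ E] : (E × E) ≃L[ℝ] (E × E) where
  toFun p := ((2⁻¹ : ℝ) • (p.1 + p.2), p.1 - p.2)
  invFun q := (q.1 + (2⁻¹ : ℝ) • q.2, q.1 - (2⁻¹ : ℝ) • q.2)
  map_add' p q := by ext <;> simp <;> module
  map_smul' c p := by ext <;> simp <;> module
  left_inv p := by ext <;> simp <;> module
  right_inv q := by ext <;> simp <;> module
  continuous_toFun := by fun_prop
  continuous_invFun := by fun_prop

/-- The inverse of the symmetric coordinate change `(𝒯ₛ F) (x, t) = F (x + t / 2, x - t / 2)`. -/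
def symmCoordInv : 𝓢(E × E, ℂ) →L[ℂ] 𝓢(E × E, ℂ) :=
  SchwartzMap.compCLMOfContinuousLinearEquiv ℂ (symmEquiv E)

@[simp] theorem symmCoordInv_apply (F : 𝓢(E × E, ℂ)) (u v : E) :
    symmCoordInv F (u, v) = F ((2⁻¹ : ℝ) • (u + v), u - v) := rfl

end Symmetric

end Operations

end SchwartzAux

namespace TimeFreq

section Definitions

open scoped SchwartzMap FourierTransform
open MeasureTheory SchwartzAux

/-- The complex conjugate of a tempered distribution, `⟨conj ν, f⟩ = conj ⟨ν, conj f⟩`. -/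
def conjDist {E : Type*} [NormedAddCommGroup E] [NormedSpace ℝ E] (ν : 𝓢'(E, ℂ)) : 𝓢'(E, ℂ) :=
  ContinuousLinearMap.toPointwiseConvergenceCLM _ _ _ _
    ({ toFun := fun f => starRingEnd ℂ (ν (conjSchwartz f))
       map_add' := fun f g => by simp
       map_smul' := fun a f => by simp
       cont := Complex.continuous_conj.comp (ν.continuous.comp conjSchwartz.continuous) } :
      𝓢(E, ℂ) →L[ℂ] ℂ)

@[simp] theorem conjDist_apply {E : Type*} [NormedAddCommGroup E] [NormedSpace ℝ E]
    (ν : 𝓢'(E, ℂ)) (f : 𝓢(E, ℂ)) : conjDist ν f = starRingEnd ℂ (ν (conjSchwartz f)) := rfl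

/-- The tensor product of tempered distributions, `⟨μ ⊗ ν, Φ⟩ = ⟨μ_u, ⟨ν_v, Φ (u, v)⟩⟩`. -/
def tensor {E F : Type*} [NormedAddCommGroup E] [NormedSpace ℝ E] [FiniteDimensional ℝ E]
    [NormedAddCommGroup F] [NormedSpace ℝ F] (μ : 𝓢'(E, ℂ)) (ν : 𝓢'(F, ℂ)) : 𝓢'(E × F, ℂ) :=
  ContinuousLinearMap.toPointwiseConvergenceCLM _ _ _ _
    ((μ : 𝓢(E, ℂ) →L[ℂ] ℂ).comp (pairSnd ν))

@[simp] theorem tensor_apply {E F : Type*} [NormedAddCommGroup E] [NormedSpace ℝ E]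
    [FiniteDimensional ℝ E] [NormedAddCommGroup F] [NormedSpace ℝ F]
    (μ : 𝓢'(E, ℂ)) (ν : 𝓢'(F, ℂ)) (Φ : 𝓢(E × F, ℂ)) : tensor μ ν Φ = μ (pairSnd ν Φ) := rfl

variable {V : Type*} [NormedAddCommGroup V] [InnerProductSpace ℝ V] [FiniteDimensional ℝ V]
  [MeasurableSpace V] [BorelSpace V]

/-- The cross-Wigner distribution of two tempered distributions, with respect to the bilinear
pairing: `⟨W(μ, ν), Φ⟩ = ⟨μ ⊗ conj ν, 𝒯ₛ⁻¹ ℱ₂ Φ⟩`. (For the sesquilinear pairing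
`⟨T, Φ⟩ = T (conj Φ)` this reads `⟨W(μ, ν), Φ⟩ = ⟨μ ⊗ conj ν, 𝒯ₛ⁻¹ ℱ₂⁻¹ Φ⟩`, since
`conj (ℱ₂⁻¹ (conj Φ)) = ℱ₂ Φ`.) -/
def crossWigner (μ ν : 𝓢'(V, ℂ)) : 𝓢'(V × V, ℂ) :=
  ContinuousLinearMap.toPointwiseConvergenceCLM _ _ _ _
    ((tensor μ (conjDist ν) : 𝓢(V × V, ℂ) →L[ℂ] ℂ).comp (symmCoordInv.comp fourierSnd))

theorem crossWigner_apply (μ ν : 𝓢'(V, ℂ)) (Φ : 𝓢(V × V, ℂ)) :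
    crossWigner μ ν Φ = tensor μ (conjDist ν) (symmCoordInv (fourierSnd Φ)) := rfl

/-- The Wigner transform `W(μ) = W(μ, μ)` of a tempered distribution. -/
def wigner (μ : 𝓢'(V, ℂ)) : 𝓢'(V × V, ℂ) := crossWigner μ μ

/-- A set is uniformly discrete if its distinct points are at distance at least some fixed
`δ > 0`. -/
def IsUniformlyDiscrete {X : Type*} [PseudoMetricSpace X] (A : Set X) : Prop :=
  ∃ δ : ℝ, 0 < δ ∧ ∀ r ∈ A, ∀ s ∈ A, r ≠ s → δ ≤ dist r s

/-- A tempered distribution is a measure if it acts on compactly supported test functions as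
integration against a complex Radon measure, written in polar form as `h m` with `m` a locally
finite positive measure and `|h| = 1`. -/
def IsMeasure {E : Type*} [NormedAddCommGroup E] [NormedSpace ℝ E] [MeasurableSpace E]
    (T : 𝓢'(E, ℂ)) : Prop :=
  ∃ (m : Measure E) (h : E → ℂ), IsFiniteMeasureOnCompacts m ∧ Measurable h ∧ (∀ x, ‖h x‖ = 1) ∧
    ∀ φ : 𝓢(E, ℂ), HasCompactSupport φ → T φ = ∫ x, φ x * h x ∂m

end Definitions

end TimeFreq

end

open scoped SchwartzMap FourierTransform

/-! Testing `W(μ)` against the partial inverse Fourier transform in `t` of `φ(x + t/2) * conj ψ(x -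
t/2)` gives `μ φ * conj (μ ψ)` (`wigner_fourierSndInv_symmProduct`). A sum of point masses on `A ×
B` sees only the values of the test function there. Hence `μ φ * conj (μ ψ)` depends only on the
slices `x = r ∈ A` of that product, that is, on the functions `a ↦ φ(a) * conj ψ(2r - a)`: this is
`MidpointDetermined`.

Replacing `φ, ψ` by their Fourier transforms rotates the Wigner transform
(`fourierSndInv_symmProduct_fourier`), so that its value at `(x, w)` is an integral of `φ(a) * conj
ψ(2w - a)`. Hence `𝓕 μ` has the same property with respect to `B`, and it remains to study a
midpoint-determined linear functional `ν`.

In a ball missing `A`, no two points have their midpoint in `A`, so the data of the pair `(φ, φ)`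
vanish and `|ν φ|² = 0`. In a ball meeting `A` only in its centre `r`, a factor of `φ` can be moved,
reflected through `r` and conjugated, onto `ψ`. This makes multiplication by `φ` act on `ν` as a
scalar, and locality forces that scalar to be `φ r`. So `ν` is a multiple of point evaluation,
without derivatives (`MidpointDetermined.apply_eq_zero_of_ball`). Partitions of unity then give `ν φ
= ∑ c r * φ r` for compactly supported `φ`, which is integration against a locally finite atomic
measure. -/

namespace TimeFreq

open MeasureTheory SchwartzAux Distribution
open scoped ContDiff Topology Manifold

/-! ### Partitions of unity and locality -/

section LocalToGlobal

variable {E : Type*} [NormedAddCommGroup E] [NormedSpace ℝ E] [FiniteDimensional ℝ E]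

theorem exists_contDiff_partition {ι : Type*} [Fintype ι] {K : Set E} (hK : IsClosed K)
    (U : ι → Set E) (hU : ∀ i, IsOpen (U i)) (hKU : K ⊆ ⋃ i, U i) :
    ∃ f : ι → E → ℂ, (∀ i, ContDiff ℝ ∞ (f i)) ∧ (∀ i, tsupport (f i) ⊆ U i) ∧
      ∀ x ∈ K, ∑ i, f i x = 1 := by
  obtain ⟨f, hf⟩ := SmoothPartitionOfUnity.exists_isSubordinate 𝓘(ℝ, E) hK U hU hKU
  refine ⟨fun i x => (f i x : ℂ), fun i => Complex.ofRealCLM.contDiff.comp (f i).contMDiff.contDiff,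
    fun i => (tsupport_comp_subset (g := fun r : ℝ => (r : ℂ)) (by simp) (f i)).trans (hf i),
    fun x hx => ?_⟩
  have h := f.sum_eq_one hx
  rw [finsum_eq_sum_of_fintype] at h
  simpa using congrArg (fun r : ℝ => (r : ℂ)) h

theorem exists_schwartz_cutoff {K U : Set E} (hK : IsClosed K) (hU : IsOpen U)
    (hb : Bornology.IsBounded U) (hKU : K ⊆ U) :
    ∃ χ : 𝓢(E, ℂ), tsupport χ ⊆ U ∧ ∀ x ∈ K, χ x = 1 := by
  obtain ⟨f, hf, hs, h1⟩ := exists_contDiff_partition hK (fun _ : Unit => U) (fun _ => hU)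
    (hKU.trans (Set.subset_iUnion (fun _ : Unit => U) ()))
  have hc : HasCompactSupport (f ()) :=
    Metric.isCompact_of_isClosed_isBounded (isClosed_tsupport _) (hb.subset (hs ()))
  exact ⟨hc.toSchwartzMap (hf ()), hs (), fun x hx => by simpa using h1 x hx⟩

/-- A linear functional that vanishes near every point of the support of a compactly supported
test function vanishes on that function. -/
theorem apply_eq_zero_of_locally {ν : 𝓢(E, ℂ) → ℂ} (hadd : ∀ f g, ν (f + g) = ν f + ν g)
    {φ : 𝓢(E, ℂ)} (hφ : HasCompactSupport φ)
    (h : ∀ x ∈ tsupport φ, ∃ U, IsOpen U ∧ x ∈ U ∧ IsVanishingOn ν U) : ν φ = 0 := by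
  choose! U hUo hxU hU using h
  obtain ⟨t, ht, hcov⟩ := hφ.isCompact.elim_nhds_subcover U
    fun x hx => (hUo x hx).mem_nhds (hxU x hx)
  obtain ⟨f, hf, hs, h1⟩ := exists_contDiff_partition (isClosed_tsupport φ)
    (fun i : t => U i) (fun i => hUo i (ht i i.2)) (by simpa [Set.iUnion_subtype] using hcov)
  have hsm : ∀ i, ContDiff ℝ ∞ (fun x => f i x * φ x) := fun i => (hf i).mul (φ.smooth ⊤)
  have hcs : ∀ i, HasCompactSupport (fun x => f i x * φ x) := fun i => hφ.mul_left
  let ψ : t → 𝓢(E, ℂ) := fun i => (hcs i).toSchwartzMap (hsm i)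
  have hsum : φ = ∑ i, ψ i := by
    ext x
    have : (∑ i, ψ i) x = ∑ i, f i x * φ x := by
      rw [sum_apply]; rfl
    rw [this, ← Finset.sum_mul]
    -- The partition sums to one only on the support of `φ`; elsewhere both sides are zero.
    by_cases hx : x ∈ tsupport φ
    · rw [h1 x hx, one_mul]
    · rw [image_eq_zero_of_notMem_tsupport hx, mul_zero]
  have hν : ∀ s : Finset t, ν (∑ i ∈ s, ψ i) = ∑ i ∈ s, ν (ψ i) := fun s =>
    map_sum (AddMonoidHom.mk' ν hadd) ψ s
  rw [hsum, hν]
  refine Finset.sum_eq_zero fun i _ => hU i (ht i i.2) _ ?_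
  exact (tsupport_mul_subset_left (f := f i) (g := φ)).trans (hs i)

end LocalToGlobal

/-! ### Uniformly discrete sets -/

section UniformlyDiscrete

theorem IsUniformlyDiscrete.isClosed {X : Type*} [MetricSpace X] {A : Set X}
    (hA : IsUniformlyDiscrete A) : IsClosed A := by
  obtain ⟨δ, hδ, h⟩ := hA
  refine Metric.isClosed_of_pairwise_le_dist hδ fun x hx y hy hxy => h x hx y hy hxy

theorem IsUniformlyDiscrete.mono {X : Type*} [PseudoMetricSpace X] {A B : Set X}
    (hA : IsUniformlyDiscrete A) (h : B ⊆ A) : IsUniformlyDiscrete B := by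
  obtain ⟨δ, hδ, h'⟩ := hA
  exact ⟨δ, hδ, fun r hr s hs => h' r (h hr) s (h hs)⟩

theorem IsUniformlyDiscrete.finite_inter {X : Type*} [MetricSpace X] {A K : Set X}
    (hA : IsUniformlyDiscrete A) (hK : IsCompact K) : (A ∩ K).Finite := by
  obtain ⟨δ, hδ, h⟩ := hA
  obtain ⟨t, -, ht, hcov⟩ := hK.finite_cover_balls (half_pos hδ)
  -- Sending a point to the centre of a covering ball of radius `δ / 2` is injective on `A`, since
  -- two points sharing a centre are closer than `δ`.
  choose! f hft hf using fun x (hx : x ∈ K) => Set.mem_iUnion₂.1 (hcov hx)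
  refine Set.Finite.of_injOn (f := f) (fun x hx => hft x hx.2) (fun x hx y hy hxy => ?_) ht
  by_contra hne
  have h1 := h x hx.1 y hy.1 hne
  have h2 : dist x (f x) < δ / 2 := hf x hx.2
  have h3 : dist y (f y) < δ / 2 := hf y hy.2
  rw [← hxy] at h3
  linarith [dist_triangle_right x y (f x)]

/-- Every subset of `A` is again uniformly discrete, hence closed, so arbitrary values on `A` cannot
spoil measurability. -/
theorem measurable_of_eq_one_off {X : Type*} [MetricSpace X]
    [MeasurableSpace X] [BorelSpace X] {A : Set X} {h : X → ℂ} (hA : IsUniformlyDiscrete A)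
    (h1 : ∀ x ∉ A, h x = 1) : Measurable h := by
  intro s _
  have e : h ⁻¹' s = (A ∩ h ⁻¹' s) ∪ (Aᶜ ∩ {_x | (1 : ℂ) ∈ s}) := by
    ext x
    by_cases hx : x ∈ A <;> simp [hx, h1]
  rw [e]
  exact (hA.mono Set.inter_subset_left).isClosed.measurableSet.union
    (hA.isClosed.measurableSet.compl.inter (MeasurableSet.const _))

end UniformlyDiscrete

/-! ### Midpoint-determined functionals away from `A` -/

section Basic

variable {E : Type*} [NormedAddCommGroup E] [NormedSpace ℝ E]

/-- The values `ν φ * conj (ν ψ)` only depend on the products `φ(a) * conj ψ(2r - a)`, `r ∈ A`. -/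
def MidpointDetermined (ν : 𝓢(E, ℂ) → ℂ) (A : Set E) : Prop :=
  ∀ φ₁ ψ₁ φ₂ ψ₂ : 𝓢(E, ℂ),
    (∀ r ∈ A, ∀ a, φ₁ a * starRingEnd ℂ (ψ₁ ((2 : ℝ) • r - a)) =
      φ₂ a * starRingEnd ℂ (ψ₂ ((2 : ℝ) • r - a))) →
    ν φ₁ * starRingEnd ℂ (ν ψ₁) = ν φ₂ * starRingEnd ℂ (ν ψ₂)

/-- `r` is the midpoint of `a` and `2r - a`, and balls are convex. -/
theorem mem_ball_of_reflect {ε : ℝ} {x r a : E} (ha : a ∈ Metric.ball x ε)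
    (hra : (2 : ℝ) • r - a ∈ Metric.ball x ε) : r ∈ Metric.ball x ε := by
  have h := (convex_ball x ε) ha hra (a := 1 / 2) (b := 1 / 2) (by norm_num) (by norm_num)
    (by norm_num)
  convert h using 1
  module

/-- The pointwise product of Schwartz functions. -/
theorem exists_mul (f g : 𝓢(E, ℂ)) : ∃ k : 𝓢(E, ℂ), ∀ x, k x = f x * g x :=
  ⟨SchwartzMap.smulLeftCLM ℂ f g, fun x => by
    rw [SchwartzMap.smulLeftCLM_apply_apply f.hasTemperateGrowth, smul_eq_mul]⟩

theorem tsupport_subset_of_eq_mul {X : Type*} [TopologicalSpace X] {f g k : X → ℂ} (h : ∀ x, k x = f x * g x) :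
    tsupport k ⊆ tsupport g := by
  rw [show k = f * g from funext h]
  exact tsupport_mul_subset_right

/-- A Schwartz function can be divided by a smooth function without zeros on its support. -/
theorem exists_div {f : 𝓢(E, ℂ)} (hf : HasCompactSupport f) {k : E → ℂ} (hk : ContDiff ℝ ∞ k)
    (h0 : ∀ x ∈ tsupport f, k x ≠ 0) : ∃ g : 𝓢(E, ℂ), tsupport g ⊆ tsupport f ∧
      ∀ x, f x = k x * g x := by
  have hsm : ContDiff ℝ ∞ (fun x => f x * (k x)⁻¹) := contDiff_iff_contDiffAt.2 fun x => by
    by_cases hx : x ∈ tsupport f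
    · exact (f.contDiffAt ⊤).mul (hk.contDiffAt.inv (h0 x hx))
    · refine (contDiffAt_const (c := (0 : ℂ))).congr_of_eventuallyEq ?_
      filter_upwards [(isClosed_tsupport f).isOpen_compl.mem_nhds hx] with y hy
      rw [image_eq_zero_of_notMem_tsupport hy, zero_mul]
  have hc : HasCompactSupport (fun x => f x * (k x)⁻¹) := hf.mul_right
  refine ⟨hc.toSchwartzMap hsm, tsupport_mul_subset_left, fun x => ?_⟩
  change f x = k x * (f x * (k x)⁻¹)
  by_cases hx : x ∈ tsupport f
  · have := h0 x hx
    field_simp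
  · rw [image_eq_zero_of_notMem_tsupport hx]; simp

/-- The Schwartz function `a ↦ conj h(2r - a)`. -/
theorem exists_reflect_conj (h : 𝓢(E, ℂ)) (r : E) :
    ∃ k : 𝓢(E, ℂ), ∀ a, k a = starRingEnd ℂ (h ((2 : ℝ) • r - a)) := by
  refine ⟨conjSchwartz (SchwartzMap.compSubConstCLM ℂ ((2 : ℝ) • r)
    (SchwartzMap.compCLMOfContinuousLinearEquiv ℂ (ContinuousLinearEquiv.neg ℝ (M := E)) h)),
    fun a => ?_⟩
  simp

theorem MidpointDetermined.isVanishingOn_ball {ν : 𝓢(E, ℂ) →ₗ[ℂ] ℂ}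
    {A : Set E} (h : MidpointDetermined ν A) {x : E} {ε : ℝ} (hd : Disjoint (Metric.ball x ε) A) :
    IsVanishingOn ν (Metric.ball x ε) := by
  intro φ hφ
  -- Comparing the pair `(φ, φ)` with `(0, 0)` yields `|ν φ|² = 0`.
  have h0 := h φ φ 0 0 fun r hr a => by
    by_cases ha : φ a = 0
    · simp [ha]
    by_cases hb : φ ((2 : ℝ) • r - a) = 0
    · simp [hb]
    have h1 := hφ (subset_tsupport _ ha)
    have h2 := hφ (subset_tsupport _ hb)
    exact (Set.disjoint_left.1 hd (mem_ball_of_reflect h1 h2) hr).elim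
  simpa using h0

theorem MidpointDetermined.exists_isVanishingOn {ν : 𝓢(E, ℂ) →ₗ[ℂ] ℂ}
    {A : Set E} (h : MidpointDetermined ν A) (hA : IsClosed A) {x : E} (hx : x ∉ A) :
    ∃ U, IsOpen U ∧ x ∈ U ∧ IsVanishingOn ν U := by
  obtain ⟨ε, hε, hb⟩ := Metric.isOpen_iff.1 hA.isOpen_compl x hx
  exact ⟨_, Metric.isOpen_ball, Metric.mem_ball_self hε,
    h.isVanishingOn_ball (Set.disjoint_left.2 fun y hy => hb hy)⟩

end Basic

/-! ### Structure at the points of `A`, and the resulting measure -/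

section Atomic

variable {E : Type*} [NormedAddCommGroup E] [NormedSpace ℝ E] [FiniteDimensional ℝ E]

variable {A : Set E}

theorem hasCompactSupport_of_subset_ball {F : Type*} [Zero F] {f : E → F} {x : E} {ε : ℝ}
    (h : tsupport f ⊆ Metric.ball x ε) : HasCompactSupport f :=
  Metric.isCompact_of_isClosed_isBounded (isClosed_tsupport _) (Metric.isBounded_ball.subset h)

/-- This excludes derivatives of the point mass at `r`. Multiplication by `φ` acts on `ν` in the
ball as a scalar `c`; if `c ≠ 0 = φ r`, then `φ - c` is invertible near `r`, which would make `ν`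
vanish there and hence on the whole ball. -/
theorem MidpointDetermined.apply_eq_zero_of_ball {ν : 𝓢(E, ℂ) →ₗ[ℂ] ℂ}
    (h : MidpointDetermined ν A) (hA : IsClosed A) {r : E} {ε : ℝ}
    (hr : A ∩ Metric.ball r ε ⊆ {r}) {φ : 𝓢(E, ℂ)} (hφ : tsupport φ ⊆ Metric.ball r ε)
    (hφr : φ r = 0) : ν φ = 0 := by
  by_cases hν : IsVanishingOn ν (Metric.ball r ε)
  · exact hν φ hφ
  obtain ⟨ψ, hψ, hνψ⟩ := not_isVanishingOn_iff.1 hν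
  obtain ⟨φ', hφ'⟩ := exists_reflect_conj φ r
  obtain ⟨φ'ψ, hφ'ψ⟩ := exists_mul φ' ψ
  have hψs : tsupport φ'ψ ⊆ Metric.ball r ε := (tsupport_subset_of_eq_mul hφ'ψ).trans hψ
  set c : ℂ := starRingEnd ℂ (ν φ'ψ) / starRingEnd ℂ (ν ψ) with hc
  have hνψ' : starRingEnd ℂ (ν ψ) ≠ 0 := by simpa using hνψ
  have key : ∀ η φη : 𝓢(E, ℂ), tsupport η ⊆ Metric.ball r ε → (∀ x, φη x = φ x * η x) →
      ν φη = c * ν η := by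
    intro η φη hη hmul
    -- The reflected factor `φ'(a) = conj φ(2r - a)` satisfies `conj φ'(2r - a) = φ(a)`, so the
    -- pairs `(φη, ψ)` and `(η, φ'ψ)` have the same product at `r`. At any other point of `A` both
    -- products vanish by the support conditions.
    have h1 := h φη ψ η φ'ψ fun s hs a => by
      by_cases ha : η a = 0
      · simp [ha, hmul]
      by_cases hb : ψ ((2 : ℝ) • s - a) = 0
      · simp [hb, hφ'ψ]
      have h1 := hη (subset_tsupport _ ha)
      have h2 := hψ (subset_tsupport _ hb)
      obtain rfl : s = r := hr ⟨hs, mem_ball_of_reflect h1 h2⟩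
      rw [hmul, hφ'ψ, hφ', map_mul, Complex.conj_conj, sub_sub_cancel]
      ring
    rw [hc]
    field_simp
    rw [h1]
    ring
  have hc0 : c = 0 := by
    by_contra hc0
    refine hνψ (apply_eq_zero_of_locally (ν := ν) (map_add ν)
      (hasCompactSupport_of_subset_ball hψ) fun x hx => ?_)
    by_cases hxr : x = r
    · subst hxr
      refine ⟨Metric.ball x ε ∩ {y | φ y ≠ c}, Metric.isOpen_ball.inter
        (isOpen_ne_fun φ.continuous continuous_const), ⟨hψ hx, by simpa [hφr] using Ne.symm hc0⟩,
        fun η hη => ?_⟩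
      have hηb := hη.trans Set.inter_subset_left
      -- With `η = (φ - c) g`, the scalar action gives `ν η = c * ν g - c * ν g = 0`.
      obtain ⟨g, hg, hηg⟩ := exists_div (f := η) (hasCompactSupport_of_subset_ball hηb)
        (k := fun y => φ y - c) ((φ.smooth ⊤).sub contDiff_const)
        fun y hy => sub_ne_zero.2 (hη hy).2
      obtain ⟨φg, hφg⟩ := exists_mul φ g
      have e : η = φg - c • g := by
        ext y
        rw [sub_apply, smul_apply, hηg, hφg, smul_eq_mul]
        ring
      rw [e, map_sub, map_smul, key g φg (hg.trans hηb) hφg, smul_eq_mul, sub_self]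
    · exact h.exists_isVanishingOn hA fun hxA => hxr (hr ⟨hxA, hψ hx⟩)
  -- Since `φ = φ χ`, the scalar action applied to `χ` evaluates `ν φ` itself.
  obtain ⟨χ, hχ, hχ1⟩ := exists_schwartz_cutoff (isClosed_tsupport φ) Metric.isOpen_ball
    Metric.isBounded_ball hφ
  rw [key χ φ hχ fun x => ?_, hc0, zero_mul]
  by_cases hx : x ∈ tsupport φ
  · rw [hχ1 x hx, mul_one]
  · rw [image_eq_zero_of_notMem_tsupport hx, zero_mul]

/-- `φ - φ r • χ` vanishes at `r` when `χ` is a cutoff with `χ r = 1`, so the constant is `ν χ`. -/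
theorem MidpointDetermined.exists_eq_mul {ν : 𝓢(E, ℂ) →ₗ[ℂ] ℂ}
    (h : MidpointDetermined ν A) (hA : IsClosed A) {r : E} {ε : ℝ} (hε : 0 < ε)
    (hr : A ∩ Metric.ball r ε ⊆ {r}) :
    ∃ c : ℂ, ∀ φ : 𝓢(E, ℂ), tsupport φ ⊆ Metric.ball r ε → ν φ = c * φ r := by
  obtain ⟨χ, hχ, hχ1⟩ := exists_schwartz_cutoff (K := {r}) isClosed_singleton
    Metric.isOpen_ball Metric.isBounded_ball
    (Set.singleton_subset_iff.2 (Metric.mem_ball_self hε))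
  refine ⟨ν χ, fun φ hφ => ?_⟩
  have h0 := h.apply_eq_zero_of_ball hA hr (φ := φ - φ r • χ) ?_ ?_
  · rw [map_sub, map_smul, sub_eq_zero] at h0
    rw [h0, smul_eq_mul, mul_comm]
  · refine (tsupport_sub _ _).trans (Set.union_subset hφ ?_)
    exact (tsupport_smul_subset_right (fun _ => φ r) χ).trans hχ
  · simp [hχ1 r rfl]

theorem MidpointDetermined.exists_eq_sum {ν : 𝓢(E, ℂ) →ₗ[ℂ] ℂ}
    (h : MidpointDetermined ν A) (hA : IsUniformlyDiscrete A) :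
    ∃ c : E → ℂ, ∀ (φ : 𝓢(E, ℂ)) (hφ : HasCompactSupport φ),
      ν φ = ∑ r ∈ (hA.finite_inter hφ.isCompact).toFinset, c r * φ r := by
  have hcl := hA.isClosed
  have hA' := hA
  obtain ⟨δ, hδ, hsep⟩ := hA'
  have hball : ∀ r ∈ A, A ∩ Metric.ball r δ ⊆ {r} := fun r hr s ⟨hs, hsr⟩ => by
    by_contra hne
    exact absurd (hsep s hs r hr hne) (not_le.2 hsr)
  choose! c hc using fun (r : E) (hr : r ∈ A) => h.exists_eq_mul hcl hδ (hball r hr)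
  refine ⟨c, fun φ hφ => ?_⟩
  set t := (hA.finite_inter hφ.isCompact).toFinset with ht
  have ht' : ∀ r, r ∈ t ↔ r ∈ A ∧ r ∈ tsupport φ := fun r => by simp [ht]
  rw [← sub_eq_zero]
  -- The index set `t` is frozen at the support of the given `φ`, which makes the difference
  -- additive in its argument so that locality applies.
  refine apply_eq_zero_of_locally (ν := fun φ => ν φ - ∑ r ∈ t, c r * φ r) (fun f g => ?_) hφ
    fun x hx => ?_
  · simp only [map_add, add_apply, mul_add, Finset.sum_add_distrib]
    ring
  have hz : ∀ {η : 𝓢(E, ℂ)} {r y : E}, tsupport η ⊆ Metric.ball y δ → r ∈ A → y ∈ A → r ≠ y →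
      η r = 0 := fun {η r y} hη hr hy hne => image_eq_zero_of_notMem_tsupport fun hmem =>
    hne (hball y hy ⟨hr, hη hmem⟩)
  by_cases hxA : x ∈ A
  · refine ⟨Metric.ball x δ, Metric.isOpen_ball, Metric.mem_ball_self hδ, fun η hη => ?_⟩
    change ν η - _ = 0
    rw [Finset.sum_eq_single_of_mem x ((ht' x).2 ⟨hxA, hx⟩), hc x hxA η hη, sub_self]
    intro r hr hne
    rw [hz hη ((ht' r).1 hr).1 hxA hne, mul_zero]
  · obtain ⟨U, hUo, hxU, hU⟩ := h.exists_isVanishingOn hcl hxA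
    -- Removing `A` from the neighbourhood kills the sum as well as `ν`.
    refine ⟨U ∩ Aᶜ, hUo.inter hcl.isOpen_compl, ⟨hxU, hxA⟩, fun η hη => ?_⟩
    change ν η - _ = 0
    rw [hU η (hη.trans Set.inter_subset_left), Finset.sum_eq_zero, sub_zero]
    intro r hr
    rw [image_eq_zero_of_notMem_tsupport fun hmem => (hη hmem).2 ((ht' r).1 hr).1, mul_zero]

variable [MeasurableSpace E] [BorelSpace E]

theorem isMeasure_of_eq_sum {T : 𝓢'(E, ℂ)} (hA : IsUniformlyDiscrete A) (c : E → ℂ)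
    (hc : ∀ (φ : 𝓢(E, ℂ)) (hφ : HasCompactSupport φ),
      T φ = ∑ r ∈ (hA.finite_inter hφ.isCompact).toFinset, c r * φ r) : IsMeasure T := by
  classical
  let m : Measure E := Measure.sum fun r : A => ENNReal.ofReal ‖c r‖ • Measure.dirac (r : E)
  -- The phase of `c`; the default value `1` keeps `|h| = 1` where `c` vanishes and makes `h`
  -- constant off `A`.
  let h : E → ℂ := fun x => if x ∈ A ∧ c x ≠ 0 then c x / ‖c x‖ else 1
  have hh : Measurable h := measurable_of_eq_one_off hA fun x hx => by simp [h, hx]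
  have hn : ∀ x, ‖h x‖ = 1 := fun x => by
    simp only [h]
    split_ifs with hx
    · have := norm_ne_zero_iff.2 hx.2
      simp [this]
    · simp
  have hm : IsFiniteMeasureOnCompacts m := ⟨fun K hK => by
    have hf : {r : A | (r : E) ∈ K}.Finite := by
      refine Set.Finite.of_finite_image ((hA.finite_inter hK).subset ?_)
        Subtype.val_injective.injOn
      rintro _ ⟨r, hr, rfl⟩
      exact ⟨r.2, hr⟩
    rw [Measure.sum_apply _ hK.measurableSet, tsum_eq_sum (s := hf.toFinset)]
    · refine ENNReal.sum_lt_top.2 fun r _ => ?_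
      rw [Measure.smul_apply, smul_eq_mul]
      exact ENNReal.mul_lt_top ENNReal.ofReal_lt_top (measure_lt_top _ _)
    · intro r hr
      have : (r : E) ∉ K := by simpa using hr
      simp [Measure.dirac_apply' _ hK.measurableSet, this]⟩
  refine ⟨m, h, hm, hh, hn, fun φ hφ => ?_⟩
  have hint : Integrable (fun x => φ x * h x) m :=
    (φ.continuous.integrable_of_hasCompactSupport hφ).mul_bdd (c := 1) hh.aestronglyMeasurable
      (Filter.Eventually.of_forall fun x => (hn x).le)
  have h1 := hasSum_integral_measure hint
  have hval : ∀ r : A, ∫ x, φ x * h x ∂(ENNReal.ofReal ‖c r‖ • Measure.dirac (r : E)) =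
      c r * φ r := fun r => by
    rw [integral_smul_measure, integral_dirac, ENNReal.toReal_ofReal (norm_nonneg _)]
    by_cases hr : c r = 0
    · simp [hr]
    · have := Complex.ofReal_ne_zero.2 (norm_ne_zero_iff.2 hr)
      simp only [h, r.2, hr, ne_eq, not_false_eq_true, and_self, if_true, Complex.real_smul]
      field_simp
  simp_rw [hval] at h1
  refine HasSum.unique ?_ h1
  rw [hc φ hφ]
  have h2 : HasSum (fun x : E => A.indicator (fun r => c r * φ r) x)
      (∑ r ∈ (hA.finite_inter hφ.isCompact).toFinset, A.indicator (fun r => c r * φ r) r) :=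
    hasSum_sum_of_ne_finset_zero fun x hx => by
      by_cases hxA : x ∈ A
      · have : x ∉ tsupport φ := fun h => hx (by simp [hxA, h])
        simp [image_eq_zero_of_notMem_tsupport this]
      · simp [hxA]
  rw [Finset.sum_congr rfl fun r hr => Set.indicator_of_mem (a := r) (s := A) ?_ _] at h2
  · exact (hasSum_subtype_iff_indicator (f := fun r => c r * φ r)).2 h2
  · exact ((Set.Finite.mem_toFinset _).1 hr).1

theorem isMeasure_and_dsupport_subset {T : 𝓢'(E, ℂ)} (hA : IsUniformlyDiscrete A)
    (h : MidpointDetermined T A) : IsMeasure T ∧ dsupport T ⊆ A := by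
  let ν : 𝓢(E, ℂ) →ₗ[ℂ] ℂ := (T : 𝓢(E, ℂ) →L[ℂ] ℂ).toLinearMap
  have h' : MidpointDetermined ν A := h
  constructor
  · obtain ⟨c, hc⟩ := h'.exists_eq_sum hA
    exact isMeasure_of_eq_sum hA c hc
  · intro x hx
    by_contra hxA
    obtain ⟨U, hUo, hxU, hU⟩ := h'.exists_isVanishingOn hA.isClosed hxA
    exact (notMem_dsupport_iff x).2 ⟨U, hU, hUo, hxU⟩ hx

end Atomic

/-! ### Tensor products of Schwartz functions -/

section TensorProduct

variable {E F : Type*} [NormedAddCommGroup E] [NormedSpace ℝ E] [NormedAddCommGroup F]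
  [NormedSpace ℝ F]

theorem norm_iteratedFDeriv_comp_fst_le (f : 𝓢(E, ℂ)) (n : ℕ) (p : E × F) :
    ‖iteratedFDeriv ℝ n (fun p : E × F => f p.1) p‖ ≤ ‖iteratedFDeriv ℝ n f p.1‖ := by
  have h := ContinuousLinearMap.iteratedFDeriv_comp_right (n := n)
    (ContinuousLinearMap.fst ℝ E F) (f.smooth n) p le_rfl
  change ‖iteratedFDeriv ℝ n (f ∘ ContinuousLinearMap.fst ℝ E F) p‖ ≤ _
  rw [h]
  refine (ContinuousMultilinearMap.norm_compContinuousLinearMap_le _ _).trans ?_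
  rw [Finset.prod_const]
  exact mul_le_of_le_one_right (norm_nonneg _)
    (pow_le_one₀ (norm_nonneg _) (ContinuousLinearMap.norm_fst_le ℝ E F))

theorem norm_iteratedFDeriv_comp_snd_le (g : 𝓢(F, ℂ)) (n : ℕ) (p : E × F) :
    ‖iteratedFDeriv ℝ n (fun p : E × F => g p.2) p‖ ≤ ‖iteratedFDeriv ℝ n g p.2‖ := by
  have h := ContinuousLinearMap.iteratedFDeriv_comp_right (n := n)
    (ContinuousLinearMap.snd ℝ E F) (g.smooth n) p le_rfl
  change ‖iteratedFDeriv ℝ n (g ∘ ContinuousLinearMap.snd ℝ E F) p‖ ≤ _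
  rw [h]
  refine (ContinuousMultilinearMap.norm_compContinuousLinearMap_le _ _).trans ?_
  rw [Finset.prod_const]
  exact mul_le_of_le_one_right (norm_nonneg _)
    (pow_le_one₀ (norm_nonneg _) (ContinuousLinearMap.norm_snd_le ℝ E F))

/-- The tensor product of Schwartz functions. -/
noncomputable def tensorSchwartz (f : 𝓢(E, ℂ)) (g : 𝓢(F, ℂ)) : 𝓢(E × F, ℂ) where
  toFun p := f p.1 * g p.2
  smooth' := ((f.smooth ⊤).comp contDiff_fst).mul ((g.smooth ⊤).comp contDiff_snd)
  decay' k n := by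
    let S := fun k i => SchwartzMap.seminorm ℝ k i f
    let T := fun k i => SchwartzMap.seminorm ℝ k i g
    refine ⟨∑ i ∈ Finset.range (n + 1), n.choose i *
      (S k i * T 0 (n - i) + S 0 i * T k (n - i)), fun p => ?_⟩
    have hmul := norm_iteratedFDeriv_mul_le (n := n) (N := n) (𝕜 := ℝ)
      (f := fun p : E × F => f p.1) (g := fun p : E × F => g p.2)
      ((f.smooth n).comp contDiff_fst) ((g.smooth n).comp contDiff_snd) p le_rfl
    refine (mul_le_mul_of_nonneg_left hmul (by positivity)).trans ?_
    rw [Finset.mul_sum]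
    refine Finset.sum_le_sum fun i _ => ?_
    have hk : ‖p‖ ^ k ≤ ‖p.1‖ ^ k + ‖p.2‖ ^ k := by
      rcases max_choice ‖p.1‖ ‖p.2‖ with h | h
      · rw [Prod.norm_def, h]; exact le_add_of_nonneg_right (by positivity)
      · rw [Prod.norm_def, h]; exact le_add_of_nonneg_left (by positivity)
    have f0 := f.norm_iteratedFDeriv_le_seminorm ℝ i p.1
    have g0 := g.norm_iteratedFDeriv_le_seminorm ℝ (n - i) p.2
    have fk := f.le_seminorm ℝ k i p.1
    have gk := g.le_seminorm ℝ k (n - i) p.2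
    calc _ ≤ (‖p.1‖ ^ k + ‖p.2‖ ^ k) * (n.choose i * ‖iteratedFDeriv ℝ i f p.1‖ *
          ‖iteratedFDeriv ℝ (n - i) g p.2‖) := by
          gcongr
          · exact norm_iteratedFDeriv_comp_fst_le f i p
          · exact norm_iteratedFDeriv_comp_snd_le g (n - i) p
      _ = n.choose i * ((‖p.1‖ ^ k * ‖iteratedFDeriv ℝ i f p.1‖) *
          ‖iteratedFDeriv ℝ (n - i) g p.2‖ + ‖iteratedFDeriv ℝ i f p.1‖ *
          (‖p.2‖ ^ k * ‖iteratedFDeriv ℝ (n - i) g p.2‖)) := by ring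
      _ ≤ _ := by gcongr

@[simp] theorem tensorSchwartz_apply (f : 𝓢(E, ℂ)) (g : 𝓢(F, ℂ)) (p : E × F) :
    tensorSchwartz f g p = f p.1 * g p.2 := rfl

theorem tensor_tensorSchwartz [FiniteDimensional ℝ E] (μ : 𝓢'(E, ℂ)) (ν : 𝓢'(F, ℂ))
    (f : 𝓢(E, ℂ)) (g : 𝓢(F, ℂ)) : tensor μ ν (tensorSchwartz f g) = μ f * ν g := by
  have h : pairSnd ν (tensorSchwartz f g) = ν g • f := by
    ext u
    have hs : slice u (tensorSchwartz f g) = f u • g := by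
      ext v
      simp
    rw [pairSnd_apply, hs, map_smul]
    simp [mul_comm]
  rw [tensor_apply, h, map_smul, smul_eq_mul, mul_comm]

end TensorProduct

/-! ### Products in symmetric coordinates -/

section SymmProduct

variable {V : Type*} [NormedAddCommGroup V] [NormedSpace ℝ V]

/-- The product `φ(x + t/2) * conj ψ(x - t/2)`. -/
noncomputable def symmProduct (φ ψ : 𝓢(V, ℂ)) : 𝓢(V × V, ℂ) :=
  SchwartzMap.compCLMOfContinuousLinearEquiv ℂ (symmEquiv V).symm
    (tensorSchwartz φ (conjSchwartz ψ))

theorem symmProduct_apply (φ ψ : 𝓢(V, ℂ)) (x t : V) : symmProduct φ ψ (x, t) =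
    φ (x + (2⁻¹ : ℝ) • t) * starRingEnd ℂ (ψ (x - (2⁻¹ : ℝ) • t)) := rfl

end SymmProduct

/-! ### The Wigner transform on product test functions -/

section Wigner

variable {V : Type*} [NormedAddCommGroup V] [InnerProductSpace ℝ V] [FiniteDimensional ℝ V]
  [MeasurableSpace V] [BorelSpace V]

/-- The partial inverse Fourier transform in the second variable. -/
noncomputable def fourierSndInv : 𝓢(V × V, ℂ) →L[ℂ] 𝓢(V × V, ℂ) :=
  (SchwartzMap.compCLMOfContinuousLinearEquiv ℂ
    ((ContinuousLinearEquiv.refl ℝ V).prodCongr (ContinuousLinearEquiv.neg ℝ (M := V)))).comp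
    fourierSnd

theorem fourierSndInv_apply (Ψ : 𝓢(V × V, ℂ)) (x w : V) :
    fourierSndInv Ψ (x, w) = 𝓕 (slice x Ψ) (-w) := rfl

theorem fourierSnd_fourierSndInv (Ψ : 𝓢(V × V, ℂ)) : fourierSnd (fourierSndInv Ψ) = Ψ := by
  ext ⟨x, t⟩
  have h : slice x (fourierSndInv Ψ) = 𝓕⁻ (slice x Ψ) := by
    ext w
    rw [slice_apply, fourierSndInv_apply, SchwartzMap.fourierInv_apply_eq]
    rfl
  change 𝓕 (slice x (fourierSndInv Ψ)) t = Ψ (x, t)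
  rw [h, FourierTransform.fourier_fourierInv_eq, slice_apply]

/-- The test function undoes both the partial Fourier transform and the coordinate change, leaving
`μ ⊗ conj μ` on the elementary tensor `φ ⊗ conj ψ`. -/
theorem wigner_fourierSndInv_symmProduct (μ : 𝓢'(V, ℂ)) (φ ψ : 𝓢(V, ℂ)) :
    wigner μ (fourierSndInv (symmProduct φ ψ)) = μ φ * starRingEnd ℂ (μ ψ) := by
  have h : symmCoordInv (symmProduct φ ψ) = tensorSchwartz φ (conjSchwartz ψ) := by
    ext p
    exact congrArg (tensorSchwartz φ (conjSchwartz ψ)) ((symmEquiv V).symm_apply_apply p)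
  have hc : conjSchwartz (conjSchwartz ψ) = ψ := by
    ext x
    simp
  rw [wigner, crossWigner_apply, fourierSnd_fourierSndInv, h, tensor_tensorSchwartz,
    conjDist_apply, hc]

/-- Evaluation at a test function is weak-* continuous, so both values are sums of the same scalar
series. -/
theorem wigner_apply_eq_of_hasSum {A B : Set V} {μ : 𝓢'(V, ℂ)} {c : V → V → ℂ}
    (hW : HasSum
      (fun p : ↥(A ×ˢ B) => c p.1.1 p.1.2 • TemperedDistribution.delta (p.1.1, p.1.2))
      (wigner μ)) {Φ Ψ : 𝓢(V × V, ℂ)} (h : ∀ r ∈ A, ∀ s ∈ B, Φ (r, s) = Ψ (r, s)) :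
    wigner μ Φ = wigner μ Ψ := by
  have hev : ∀ Φ : 𝓢(V × V, ℂ), HasSum (fun p : ↥(A ×ˢ B) => c p.1.1 p.1.2 * Φ (p.1.1, p.1.2))
      (wigner μ Φ) := fun Φ => by
    exact hW.mapL (PointwiseConvergenceCLM.evalCLM (RingHom.id ℂ) ℂ Φ)
  refine (hev Φ).unique ?_
  convert hev Ψ using 3 with p
  exact h _ p.2.1 _ p.2.2

theorem midpointDetermined_of_hasSum {A B : Set V} {μ : 𝓢'(V, ℂ)} {c : V → V → ℂ}
    (hW : HasSum
      (fun p : ↥(A ×ˢ B) => c p.1.1 p.1.2 • TemperedDistribution.delta (p.1.1, p.1.2))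
      (wigner μ)) : MidpointDetermined μ A := by
  intro φ₁ ψ₁ φ₂ ψ₂ h
  rw [← wigner_fourierSndInv_symmProduct, ← wigner_fourierSndInv_symmProduct]
  refine wigner_apply_eq_of_hasSum hW fun r hr s _ => ?_
  rw [fourierSndInv_apply, fourierSndInv_apply]
  congr 2
  ext t
  -- With `a = r + t/2`, the reflected point `2r - a` is `r - t/2`, so the whole slices at `r`
  -- agree.
  have h1 := h r hr (r + (2⁻¹ : ℝ) • t)
  rw [show (2 : ℝ) • r - (r + (2⁻¹ : ℝ) • t) = r - (2⁻¹ : ℝ) • t by module] at h1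
  simpa only [slice_apply, symmProduct_apply] using h1

/-! ### Rotation of the Wigner transform and the Fourier side -/

theorem fourier_modulate (φ : V → ℂ) (x τ : V) :
    𝓕 (fun a => Real.fourierChar (-inner ℝ a x) • φ a) τ = 𝓕 φ (x + τ) := by
  rw [Real.fourier_eq, Real.fourier_eq]
  congr 1
  ext a
  rw [smul_smul, ← AddChar.map_add_eq_mul, inner_add_right]
  congr 2
  ring

theorem conj_fourierChar_smul (t : ℝ) (z : ℂ) : starRingEnd ℂ (Real.fourierChar t • z) =
    Real.fourierChar (-t) • starRingEnd ℂ z := by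
  rw [Circle.smul_def, Circle.smul_def, smul_eq_mul, smul_eq_mul, map_mul,
    AddChar.map_neg_eq_inv, Circle.coe_inv_eq_conj]

theorem fourier_reflect_conj_fourier (ψ : 𝓢(V, ℂ)) (x w a : V) :
    𝓕 (fun τ => Real.fourierChar (2 * inner ℝ τ w) • starRingEnd ℂ (𝓕 ψ (x - τ))) a =
      Real.fourierChar (inner ℝ x ((2 : ℝ) • w - a)) • starRingEnd ℂ (ψ ((2 : ℝ) • w - a)) := by
  have hinv : ψ ((2 : ℝ) • w - a) =
      ∫ σ, Real.fourierChar (inner ℝ σ ((2 : ℝ) • w - a)) • 𝓕 ψ σ := by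
    conv_lhs => rw [← FourierTransform.fourierInv_fourier_eq (F := 𝓢(V, ℂ)) ψ]
    rw [SchwartzMap.fourierInv_coe, Real.fourierInv_eq]
  -- Substituting `τ = x - σ` turns the integral into the conjugate of Fourier inversion for `ψ` at
  -- `2w - a`, up to a phase.
  rw [Real.fourier_eq, ← integral_sub_left_eq_self _ volume x, hinv, ← integral_conj,
    Circle.smul_def, ← integral_smul]
  congr 1
  ext σ
  rw [← Circle.smul_def, sub_sub_cancel, conj_fourierChar_smul, smul_smul, smul_smul, ← AddChar.map_add_eq_mul,
    ← AddChar.map_add_eq_mul]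
  congr 2
  simp only [inner_sub_left, inner_sub_right, inner_smul_right]
  ring

/-- The cross-Wigner transform of `𝓕 φ` and `𝓕 ψ` is that of `φ` and `ψ`, rotated. -/
theorem fourierSndInv_symmProduct_fourier (φ ψ : 𝓢(V, ℂ)) (x w : V) :
    fourierSndInv (symmProduct (𝓕 φ) (𝓕 ψ)) (x, w) =
      |(((2⁻¹ : ℝ) ^ Module.finrank ℝ V)⁻¹)| •
        ∫ a, Real.fourierChar (2 * inner ℝ (w - a) x) •
          (φ a * starRingEnd ℂ (ψ ((2 : ℝ) • w - a))) := by
  -- After `t = 2τ` (Jacobian `2 ^ finrank`), the integrand is `𝓕 f * g`: modulation turns `𝓕 φ (x +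
  -- τ)` into `𝓕 f τ`, and `g` absorbs the rest. The identity `∫ 𝓕 f * g = ∫ f * 𝓕 g` then returns
  -- to `φ` and `ψ`.
  let f : V → ℂ := fun a => Real.fourierChar (-inner ℝ a x) • φ a
  let g : V → ℂ := fun τ => Real.fourierChar (2 * inner ℝ τ w) • starRingEnd ℂ (𝓕 ψ (x - τ))
  have hf : Integrable f :=
    (Real.fourierIntegral_convergent_iff x).2 φ.integrable
  have hg : Integrable g := by
    have h1 : Integrable fun τ => conjSchwartz (𝓕 ψ) (x - τ) :=
      (conjSchwartz (𝓕 ψ)).integrable.comp_sub_left x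
    have h2 := (Real.fourierIntegral_convergent_iff (-(2 : ℝ) • w)).2 h1
    refine h2.congr (Filter.Eventually.of_forall fun τ => ?_)
    simp [g, inner_smul_right]
  have hfg : ∫ τ, 𝓕 f τ * g τ = ∫ a, f a * 𝓕 g a := by
    simpa only [flip_innerₗ, smul_eq_mul] using! VectorFourier.integral_fourierIntegral_smul_eq_flip (L := innerₗ V)
      Real.continuous_fourierChar continuous_inner hf hg
  calc fourierSndInv (symmProduct (𝓕 φ) (𝓕 ψ)) (x, w)
      = ∫ t : V, 𝓕 f ((2⁻¹ : ℝ) • t) * g ((2⁻¹ : ℝ) • t) := by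
        rw [fourierSndInv_apply, SchwartzMap.fourier_coe, Real.fourier_eq]
        congr 1
        ext t
        rw [fourier_modulate, slice_apply, symmProduct_apply, mul_smul_comm,
          ← SchwartzMap.fourier_coe]
        congr 2
        simp [inner_smul_left]
    _ = |(((2⁻¹ : ℝ) ^ Module.finrank ℝ V)⁻¹)| • ∫ a, f a * 𝓕 g a := by
        rw [Measure.integral_comp_smul volume (fun t => 𝓕 f t * g t), hfg]
    _ = _ := by
        congr 2
        ext a
        rw [fourier_reflect_conj_fourier, smul_mul_smul_comm, ← AddChar.map_add_eq_mul]
        congr 2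
        simp only [inner_sub_right, inner_smul_right, real_inner_comm x]
        ring

theorem midpointDetermined_fourier_of_hasSum {A B : Set V} {μ : 𝓢'(V, ℂ)} {c : V → V → ℂ}
    (hW : HasSum
      (fun p : ↥(A ×ˢ B) => c p.1.1 p.1.2 • TemperedDistribution.delta (p.1.1, p.1.2))
      (wigner μ)) : MidpointDetermined (𝓕 μ : 𝓢'(V, ℂ)) B := by
  intro φ₁ ψ₁ φ₂ ψ₂ h
  simp only [TemperedDistribution.fourier_apply]
  rw [← wigner_fourierSndInv_symmProduct, ← wigner_fourierSndInv_symmProduct]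
  refine wigner_apply_eq_of_hasSum hW fun r _ s hs => ?_
  rw [fourierSndInv_symmProduct_fourier, fourierSndInv_symmProduct_fourier]
  -- After rotation the frequency `s ∈ B` plays the role of the midpoint, and `x` enters only
  -- through the phase.
  simp_rw [h s hs]

end Wigner

end TimeFreq

theorem theorem1 (d : ℕ) (A B : Set (EuclideanSpace ℝ (Fin d)))
    (hA : TimeFreq.IsUniformlyDiscrete A) (hB : TimeFreq.IsUniformlyDiscrete B)
    (μ : 𝓢'(EuclideanSpace ℝ (Fin d), ℂ))
    (c : EuclideanSpace ℝ (Fin d) → EuclideanSpace ℝ (Fin d) → ℂ)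
    (hW : HasSum
      (fun p : ↥(A ×ˢ B) => c p.1.1 p.1.2 • TemperedDistribution.delta (p.1.1, p.1.2))
      (TimeFreq.wigner μ)) :
    (TimeFreq.IsMeasure μ ∧ Distribution.dsupport μ ⊆ A) ∧
      (TimeFreq.IsMeasure (𝓕 μ : 𝓢'(EuclideanSpace ℝ (Fin d), ℂ)) ∧ Distribution.dsupport (𝓕 μ : 𝓢'(EuclideanSpace ℝ (Fin d), ℂ)) ⊆ B) :=
  ⟨TimeFreq.isMeasure_and_dsupport_subset hA (TimeFreq.midpointDetermined_of_hasSum hW),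
    TimeFreq.isMeasure_and_dsupport_subset hB (TimeFreq.midpointDetermined_fourier_of_hasSum hW)⟩
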